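/- Let $r$ be an integer with $1\le r\le 8$, let $m\ge 0$ be an integer, and write $m=a\binom{r+1}{2}+b$ with integers $a\ge 0$ and $0\le b<\binom{r+1}{2}$. All graphs are finite and simple, with an arbitrary number of vertices. For a graph $G$ let $k_3(G)$ denote the number of triangles (complete subgraphs on three vertices) in $G$. Let $\mathcal{C}(b)$ be the colex graph with $b$ edges, whose edges are the first $b$ two-element subsets of $\{0,1,2,\dots\}$ in colexicographic order (where $\{i<j\}$ precedes $\{i'<j'\}$ if $j<j'$, or $j=j'$ and $i<i'$), isolated vertices being immaterial. Let $aK_{r+1}\cup\mathcal{C}(b)$ be the disjoint union of $a$ copies of the complete graph $K_{r+1}$ and one copy of $\mathcal{C}(b)$. Then $aK_{r+1}\cup\mathcal{C}(b)$ has exactly $m$ edges and maximum degree at most $r$, and every graph $G$ with $m$ edges and maximum degree at most $r$ satisfies $$k_3(G)\le k_3\bigl(aK_{r+1}\cup\mathcal{C}(b)\bigr).$$ That is, $aK_{r+1}\cup\mathcal{C}(b)$ has the maximum number of triangles among all graphs with $m$ edges and maximum degree at most $r$. -/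

import Mathlib

/-- The colex graph `C(b)`: its edges are the first `b` pairs in colexicographic order, i.e. those
pairs `{i, j}` that are preceded in that order by fewer than `b` pairs. The first `b` pairs of
natural numbers all lie in `{0, …, b}`, which is taken as the vertex set; vertices that are in none
of these pairs are isolated. -/
def colexGraph (b : ℕ) : SimpleGraph (Fin (b + 1)) where
  Adj i j := i ≠ j ∧
    (((Finset.univ : Finset (Fin (b + 1))).powersetCard 2).filter
      (fun s => toColex s < toColex ({i, j} : Finset (Fin (b + 1))))).card < b
  symm := ⟨fun i j h => ⟨h.1.symm, by rw [Finset.pair_comm]; exact h.2⟩⟩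
  loopless := ⟨fun _ h => h.1 rfl⟩

instance (b : ℕ) : DecidableRel (colexGraph b).Adj := fun i j =>
  inferInstanceAs (Decidable (i ≠ j ∧
    (((Finset.univ : Finset (Fin (b + 1))).powersetCard 2).filter
      (fun s => toColex s < toColex ({i, j} : Finset (Fin (b + 1))))).card < b))

/-- The disjoint union `aG` of `a` copies of the graph `G`. -/
def disjointCopies (a : ℕ) {V : Type*} (G : SimpleGraph V) : SimpleGraph (Fin a × V) where
  Adj x y := x.1 = y.1 ∧ G.Adj x.2 y.2
  symm := ⟨fun _ _ h => ⟨h.1.symm, h.2.symm⟩⟩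
  loopless := ⟨fun _ h => G.irrefl h.2⟩

instance (a : ℕ) {V : Type*} (G : SimpleGraph V) [DecidableRel G.Adj] :
    DecidableRel (disjointCopies a G).Adj := fun x y =>
  inferInstanceAs (Decidable (x.1 = y.1 ∧ G.Adj x.2 y.2))

/-- The graph `aK_{r+1} ∪ C(b)`: the disjoint union of `a` complete graphs on `r + 1` vertices and
the colex graph on `b` edges. -/
def cliquesWithColex (r a b : ℕ) : SimpleGraph ((Fin a × Fin (r + 1)) ⊕ Fin (b + 1)) :=
  SimpleGraph.sum (disjointCopies a (⊤ : SimpleGraph (Fin (r + 1)))) (colexGraph b)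

instance (r a b : ℕ) : DecidableRel (cliquesWithColex r a b).Adj
  | .inl x, .inl y => inferInstanceAs
      (Decidable ((disjointCopies a (⊤ : SimpleGraph (Fin (r + 1)))).Adj x y))
  | .inr x, .inr y => inferInstanceAs (Decidable ((colexGraph b).Adj x y))
  | .inl _, .inr _ => isFalse (by simp [cliquesWithColex])
  | .inr _, .inl _ => isFalse (by simp [cliquesWithColex])

/-- `k_t(G)`: the number of complete subgraphs of size `t` in the finite graph `G`. -/
def cliqueCount (t : ℕ) {V : Type*} [Fintype V] [DecidableEq V] (G : SimpleGraph V)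
    [DecidableRel G.Adj] : ℕ :=
  (G.cliqueFinset t).card

/-! Triangles are counted as ordered triples of a 0-1 function, so `triSum univ` is six times their
number and the target is `6 * triBound r m`.

If m < C(r+1,2) ≤ 36, the degree condition is not needed: the claim is Kruskal-Katona for triangles
(`triSum_le_colexTri`), proved by removing a vertex of least positive degree.

For larger m the proof is by strong induction on m. Call an edge tight if it lies in r-1 triangles,
the most that the degrees allow. The ends of a tight edge have the same closed neighbourhood N, with
r+1 vertices. Delete all edges meeting N. If e edges and at most `triBound r e` triangles disappear,
then induction and the superadditivity of `triBound` (`triBound_add_le`) give the bound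
(`triSum_le_of_deleteMeeting`). The loss is controlled by `deleteMeeting_bound` in terms of the
graph of edges missing inside N and of the number O of edges leaving N. Goodman's inequality and two
upper bounds for the sum of squared degrees, applied to the missing graph, reduce the comparison to
a finite check (`triBoundTable_tight`).

If no edge is tight, every edge lies in at most r-2 triangles, so there are at most m(r-2)/3
triangles. For r ≤ 7 this is less than `triBound r m + 1`, which suffices by integrality. For r = 8
it can exceed the target, by one, only if every edge lies in exactly 6 triangles and m < 72. Then
either all degrees are at most 7 and the case r = 7 applies, or some vertex has degree 8; its
neighbourhood is complete up to a perfect matching, and its closed neighbourhood is deleted as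
before. -/

open Finset

/-! ### Adjacency functions and inequalities for degree sums -/

/-- `a` is the `0`-`1` adjacency function of a simple graph. -/
structure IsAdj {V : Type*} (a : V → V → ℤ) : Prop where
  zero_or_one : ∀ x y, a x y = 0 ∨ a x y = 1
  symm : ∀ x y, a x y = a y x
  diag : ∀ x, a x x = 0

/-- The number of ordered triangles with vertices in `N`. -/
def triSum {V : Type*} (N : Finset V) (a : V → V → ℤ) : ℤ :=
  ∑ x ∈ N, ∑ y ∈ N, ∑ z ∈ N, a x y * a y z * a x z

/-- The adjacency function left when all edges meeting `N` are deleted. -/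
def deleteMeeting {V : Type*} [DecidableEq V] (N : Finset V) (a : V → V → ℤ) (x y : V) : ℤ :=
  if x ∈ N ∨ y ∈ N then 0 else a x y

namespace IsAdj

variable {V : Type*} {a : V → V → ℤ}

theorem nonneg (h : IsAdj a) (x y : V) : 0 ≤ a x y := by
  rcases h.zero_or_one x y with h | h <;> simp [h]

theorem le_one (h : IsAdj a) (x y : V) : a x y ≤ 1 := by
  rcases h.zero_or_one x y with h | h <;> simp [h]

theorem sq (h : IsAdj a) (x y : V) : a x y * a x y = a x y := by
  rcases h.zero_or_one x y with h | h <;> simp [h]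

theorem deleteMeeting [DecidableEq V] (h : IsAdj a) (N : Finset V) :
    IsAdj (deleteMeeting N a) where
  zero_or_one x y := by
    unfold _root_.deleteMeeting
    split_ifs
    · exact Or.inl rfl
    · exact h.zero_or_one x y
  symm x y := by simp only [_root_.deleteMeeting, h.symm x y, or_comm]
  diag x := by simp [_root_.deleteMeeting, h.diag x]

/-- This handshake parity turns ordered sums into edge counts, and applied to neighbourhoods it
gives divisibility of `triSum` by six. -/
theorem even_sum (h : IsAdj a) (S : Finset V) : Even (∑ x ∈ S, ∑ y ∈ S, a x y) := by
  classical
  induction S using Finset.induction_on with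
  | empty => simp
  | insert v S hv ih =>
    have : ∑ x ∈ insert v S, ∑ y ∈ insert v S, a x y
        = ∑ x ∈ S, ∑ y ∈ S, a x y + 2 * ∑ y ∈ S, a v y := by
      simp only [Finset.sum_insert hv, Finset.sum_add_distrib, h.diag]
      rw [Finset.sum_congr rfl fun x _ => h.symm x v]
      ring
    rw [this]
    exact ih.add (even_two_mul _)

theorem _root_.sum_mul_deg_left (a : V → V → ℤ) (S : Finset V) :
    ∑ x ∈ S, ∑ y ∈ S, a x y * ∑ z ∈ S, a x z = ∑ x ∈ S, (∑ y ∈ S, a x y) ^ 2 :=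
  Finset.sum_congr rfl fun x _ => by rw [← Finset.sum_mul, _root_.sq]

theorem sum_mul_deg (h : IsAdj a) (S : Finset V) :
    ∑ x ∈ S, ∑ y ∈ S, a x y * ∑ z ∈ S, a y z = ∑ x ∈ S, (∑ y ∈ S, a x y) ^ 2 := by
  rw [Finset.sum_comm]
  refine Finset.sum_congr rfl fun y _ => ?_
  rw [← Finset.sum_mul, _root_.sq, Finset.sum_congr rfl fun x _ => h.symm x y]

/-- Goodman's bound for the number of triangles. -/
theorem goodman (h : IsAdj a) (S : Finset V) :
    2 * ∑ x ∈ S, (∑ y ∈ S, a x y) ^ 2 - #S * ∑ x ∈ S, ∑ y ∈ S, a x y ≤ triSum S a := by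
  -- By inclusion-exclusion, adjacent x and y have at least d(x) + d(y) - #S common neighbours in S.
  have h1 : ∀ x ∈ S, ∀ y ∈ S, a x y * (∑ z ∈ S, a x z + ∑ z ∈ S, a y z - #S)
      ≤ ∑ z ∈ S, a x y * a y z * a x z := by
    intro x _ y _
    rw [← Finset.sum_add_distrib, Finset.cast_card, ← Finset.sum_sub_distrib, Finset.mul_sum]
    refine Finset.sum_le_sum fun z _ => ?_
    rcases h.zero_or_one x y with h1 | h1 <;> rcases h.zero_or_one x z with h2 | h2 <;>
      rcases h.zero_or_one y z with h3 | h3 <;> simp [h1, h2, h3]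
  refine le_trans (le_of_eq ?_) (Finset.sum_le_sum fun x hx => Finset.sum_le_sum (h1 x hx))
  simp only [mul_sub, mul_add, Finset.sum_add_distrib, Finset.sum_sub_distrib, 
    h.sum_mul_deg, sum_mul_deg_left]
  simp only [← Finset.sum_mul]
  ring

theorem triSum_nonneg (h : IsAdj a) (S : Finset V) : 0 ≤ triSum S a :=
  Finset.sum_nonneg fun _ _ => Finset.sum_nonneg fun _ _ => Finset.sum_nonneg fun _ _ =>
    mul_nonneg (mul_nonneg (h.nonneg _ _) (h.nonneg _ _)) (h.nonneg _ _)

/-- The degrees of adjacent vertices sum to at most one more than the number of edges. -/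
theorem deg_add_deg_le (h : IsAdj a) (S : Finset V) {x y : V} (hx : x ∈ S) (hy : y ∈ S)
    (hxy : a x y = 1) :
    2 * (∑ z ∈ S, a x z + ∑ z ∈ S, a y z) ≤ ∑ z ∈ S, ∑ w ∈ S, a z w + 2 := by
  classical
  have hne : x ≠ y := by rintro rfl; simp [h.diag] at hxy
  have hy' : y ∈ S.erase x := Finset.mem_erase.2 ⟨hne.symm, hy⟩
  have split : ∀ f : V → ℤ, ∑ z ∈ S, f z = f x + (f y + ∑ z ∈ (S.erase x).erase y, f z) :=
    fun f => by rw [Finset.add_sum_erase _ _ hy', Finset.add_sum_erase _ _ hx]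
  have h1 : ∑ z ∈ (S.erase x).erase y, (a x z + a y z)
      ≤ ∑ z ∈ (S.erase x).erase y, ∑ w ∈ S, a z w := by
    refine Finset.sum_le_sum fun z _ => ?_
    rw [split (a z), h.symm z x, h.symm z y]
    have := Finset.sum_nonneg (s := (S.erase x).erase y) fun w _ => h.nonneg z w
    linarith
  have h2 := split (a x)
  have h3 := split (a y)
  have h4 := split fun z => ∑ w ∈ S, a z w
  rw [Finset.sum_add_distrib] at h1
  simp only [h.diag, hxy, h.symm y x] at h2 h3
  linarith

/-- Summing d(x) + d(y) over ordered adjacent pairs counts each squared degree twice, and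
`deg_add_deg_le` bounds every summand. This bound is meant for sparse graphs, `sum_deg_sq_le'` for
dense ones. -/
theorem sum_deg_sq_le (h : IsAdj a) (S : Finset V) :
    4 * ∑ x ∈ S, (∑ y ∈ S, a x y) ^ 2
      ≤ (∑ x ∈ S, ∑ y ∈ S, a x y) * (∑ x ∈ S, ∑ y ∈ S, a x y + 2) := by
  have key : ∑ x ∈ S, ∑ y ∈ S, a x y * (2 * (∑ z ∈ S, a x z + ∑ z ∈ S, a y z))
      ≤ ∑ x ∈ S, ∑ y ∈ S, a x y * (∑ z ∈ S, ∑ w ∈ S, a z w + 2) := by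
    refine Finset.sum_le_sum fun x hx => Finset.sum_le_sum fun y hy => ?_
    rcases h.zero_or_one x y with h1 | h1
    · simp [h1]
    · rw [h1, one_mul, one_mul]; exact h.deg_add_deg_le S hx hy h1
  have e : ∑ x ∈ S, ∑ y ∈ S, a x y * (2 * (∑ z ∈ S, a x z + ∑ z ∈ S, a y z))
      = 2 * (∑ x ∈ S, ∑ y ∈ S, a x y * ∑ z ∈ S, a x z
        + ∑ x ∈ S, ∑ y ∈ S, a x y * ∑ z ∈ S, a y z) := by
    simp only [Finset.mul_sum, ← Finset.sum_add_distrib]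
    exact Finset.sum_congr rfl fun x _ => Finset.sum_congr rfl fun y _ =>
      Finset.sum_congr rfl fun z _ => by ring
  rw [e, h.sum_mul_deg, sum_mul_deg_left] at key
  simp only [← Finset.sum_mul] at key
  linarith

theorem deg_le (h : IsAdj a) (S : Finset V) {x : V} (hx : x ∈ S) :
    ∑ y ∈ S, a x y ≤ #S - 1 := by
  classical
  rw [← Finset.add_sum_erase _ _ hx, h.diag, zero_add]
  refine (Finset.sum_le_sum fun y _ => h.le_one x y).trans ?_
  rw [Finset.sum_const, Finset.card_erase_of_mem hx, nsmul_eq_mul, mul_one,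
    Nat.cast_sub (Finset.card_pos.2 ⟨x, hx⟩)]
  simp

theorem sum_le (h : IsAdj a) (S : Finset V) :
    ∑ x ∈ S, ∑ y ∈ S, a x y ≤ #S * (#S - 1) := by
  refine (Finset.sum_le_sum fun x hx => h.deg_le S hx).trans ?_
  rw [Finset.sum_const, nsmul_eq_mul]

/-- A bound of de Caen type for the sum of the squares of the degrees. -/
theorem sum_deg_sq_le' (h : IsAdj a) (S : Finset V) :
    (2 * #S - 1) * ∑ x ∈ S, (∑ y ∈ S, a x y) ^ 2
      ≤ (∑ x ∈ S, ∑ y ∈ S, a x y) ^ 2 + (∑ x ∈ S, ∑ y ∈ S, a x y) * (#S - 1) ^ 2 := by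
  classical
  set d : V → ℤ := fun x => ∑ y ∈ S, a x y with hd
  set P := ∑ x ∈ S, ∑ y ∈ S, a x y with hP
  -- The degree sum over the neighbours of x is at most P - d(x) and at most d(x)(#S - 1). The two
  -- bounds are combined with weights d(x) and #S - 1 - d(x).
  have key : ∀ x ∈ S, (#S - 1 : ℤ) * ∑ y ∈ S, a x y * d y
      ≤ d x * (P - d x) + (#S - 1 - d x) * (d x * (#S - 1)) := by
    intro x hx
    have hd0 : 0 ≤ d x := Finset.sum_nonneg fun y _ => h.nonneg x y
    have hdk : d x ≤ #S - 1 := h.deg_le S hx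
    have h1 : ∑ y ∈ S, a x y * d y ≤ P - d x := by
      have : P = d x + ∑ y ∈ S.erase x, d y := (Finset.add_sum_erase _ _ hx).symm
      rw [this, ← Finset.add_sum_erase _ _ hx, h.diag, zero_mul, zero_add, add_sub_cancel_left]
      refine Finset.sum_le_sum fun y _ => ?_
      have : 0 ≤ d y := Finset.sum_nonneg fun z _ => h.nonneg y z
      nlinarith [h.le_one x y]
    have h2 : ∑ y ∈ S, a x y * d y ≤ d x * (#S - 1) := by
      rw [hd, Finset.sum_mul]
      exact Finset.sum_le_sum fun y hy => mul_le_mul_of_nonneg_left (h.deg_le S hy) (h.nonneg x y)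
    nlinarith [mul_le_mul_of_nonneg_left h1 hd0,
      mul_le_mul_of_nonneg_left h2 (sub_nonneg.2 hdk)]
  have := Finset.sum_le_sum key
  rw [← Finset.mul_sum, h.sum_mul_deg] at this
  have e : ∑ x ∈ S, (d x * (P - d x) + (#S - 1 - d x) * (d x * (#S - 1)))
      = P * P + P * (#S - 1) ^ 2 - #S * ∑ x ∈ S, d x ^ 2 := by
    have : ∀ x, d x * (P - d x) + (#S - 1 - d x) * (d x * (#S - 1))
        = d x * P + d x * (#S - 1) ^ 2 - #S * d x ^ 2 := fun x => by ring
    simp only [this, Finset.sum_sub_distrib, Finset.sum_add_distrib, ← Finset.sum_mul,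
      ← Finset.mul_sum]
    rfl
  rw [e] at this
  linarith

end IsAdj

/-! ### Complements, and splitting edge and triangle counts along a vertex set -/

section

variable {V : Type*} {a : V → V → ℤ}

/-- The complement of `a`. -/
def missing [DecidableEq V] (a : V → V → ℤ) (x y : V) : ℤ := (if x = y then 0 else 1) - a x y

theorem missing_of_ne [DecidableEq V] {x y : V} (h : x ≠ y) : missing a x y = 1 - a x y := by
  simp [missing, h]

namespace IsAdj

theorem missing [DecidableEq V] (h : IsAdj a) : IsAdj (missing a) where
  zero_or_one x y := by
    unfold _root_.missing
    split_ifs with hxy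
    · subst hxy; simp [h.diag]
    · rcases h.zero_or_one x y with h | h <;> simp [h]
  symm x y := by simp only [_root_.missing, h.symm x y, eq_comm]
  diag x := by simp [_root_.missing, h.diag]

theorem deg_missing [DecidableEq V] (a : V → V → ℤ) (S : Finset V) {x : V} (hx : x ∈ S) :
    ∑ y ∈ S, _root_.missing a x y = #S - 1 - ∑ y ∈ S, a x y := by
  have : ∑ y ∈ S, (if x = y then (0 : ℤ) else 1) = #S - 1 := by
    rw [← Finset.add_sum_erase _ _ hx, if_pos rfl, zero_add,
      Finset.sum_congr rfl fun y hy => if_neg (Finset.ne_of_mem_erase hy).symm, Finset.sum_const,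
      Finset.card_erase_of_mem hx, nsmul_eq_mul, mul_one, Nat.cast_sub (Finset.card_pos.2 ⟨x, hx⟩)]
    simp
  simp only [_root_.missing, Finset.sum_sub_distrib, this]

theorem sum_univ_eq [Fintype V] [DecidableEq V] (h : IsAdj a) (N : Finset V) :
    ∑ x, ∑ y, a x y = ∑ x, ∑ y, _root_.deleteMeeting N a x y + ∑ x ∈ N, ∑ y ∈ N, a x y
      + 2 * ∑ x ∈ N, ∑ y ∈ Nᶜ, a x y := by
  have e1 : ∑ x ∈ Nᶜ, ∑ y ∈ N, a x y = ∑ x ∈ N, ∑ y ∈ Nᶜ, a x y := by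
    rw [Finset.sum_comm]
    exact Finset.sum_congr rfl fun x _ => Finset.sum_congr rfl fun y _ => h.symm _ _
  have e2 : ∑ x, ∑ y, _root_.deleteMeeting N a x y = ∑ x ∈ Nᶜ, ∑ y ∈ Nᶜ, a x y := by
    have : ∀ x y, _root_.deleteMeeting N a x y
        = if x ∈ Nᶜ then if y ∈ Nᶜ then a x y else 0 else 0 := by
      intro x y
      by_cases hx : x ∈ N <;> by_cases hy : y ∈ N <;> simp [_root_.deleteMeeting, hx, hy]
    simp only [this, Finset.sum_ite_irrel, Finset.sum_const_zero, Finset.sum_ite_mem,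
      Finset.univ_inter]
  rw [e2]
  simp only [← Finset.sum_add_sum_compl N, Finset.sum_add_distrib, e1]
  ring

/-- Ordered triangles are sorted by how many vertices lie in N. The factors 3 count the positions of
the one vertex on the other side; the triangles avoiding N are those that survive the deletion. -/
theorem triSum_univ_eq [Fintype V] [DecidableEq V] (h : IsAdj a) (N : Finset V) :
    triSum univ a = triSum univ (_root_.deleteMeeting N a) + triSum N a
      + 3 * ∑ x ∈ N, ∑ y ∈ N, ∑ z ∈ Nᶜ, a x y * a y z * a x z
      + 3 * ∑ x ∈ N, ∑ y ∈ Nᶜ, ∑ z ∈ Nᶜ, a x y * a y z * a x z := by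
  have swap12 : ∀ A B C : Finset V, ∑ x ∈ A, ∑ y ∈ B, ∑ z ∈ C, a x y * a y z * a x z
      = ∑ x ∈ B, ∑ y ∈ A, ∑ z ∈ C, a x y * a y z * a x z := by
    intro A B C
    rw [Finset.sum_comm]
    refine Finset.sum_congr rfl fun x _ => Finset.sum_congr rfl fun y _ =>
      Finset.sum_congr rfl fun z _ => ?_
    rw [h.symm x y]; ring
  have swap23 : ∀ A B C : Finset V, ∑ x ∈ A, ∑ y ∈ B, ∑ z ∈ C, a x y * a y z * a x z
      = ∑ x ∈ A, ∑ y ∈ C, ∑ z ∈ B, a x y * a y z * a x z := by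
    intro A B C
    refine Finset.sum_congr rfl fun x _ => ?_
    rw [Finset.sum_comm]
    refine Finset.sum_congr rfl fun y _ => Finset.sum_congr rfl fun z _ => ?_
    rw [h.symm y z]; ring
  have e2 : triSum univ (_root_.deleteMeeting N a) = triSum Nᶜ a := by
    have : ∀ x y z, _root_.deleteMeeting N a x y * _root_.deleteMeeting N a y z
          * _root_.deleteMeeting N a x z
        = if x ∈ Nᶜ then if y ∈ Nᶜ then if z ∈ Nᶜ then a x y * a y z * a x z else 0 else 0
          else 0 := by
      intro x y z
      by_cases hx : x ∈ N <;> by_cases hy : y ∈ N <;> by_cases hz : z ∈ N <;>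
        simp [_root_.deleteMeeting, hx, hy, hz]
    simp only [triSum, this, Finset.sum_ite_irrel, Finset.sum_const_zero, Finset.sum_ite_mem,
      Finset.univ_inter]
  rw [e2]
  simp only [triSum, ← Finset.sum_add_sum_compl N, Finset.sum_add_distrib]
  rw [swap23 N Nᶜ N, swap12 Nᶜ N N, swap23 N Nᶜ N, swap12 Nᶜ N Nᶜ, swap23 Nᶜ Nᶜ N, swap12 Nᶜ N Nᶜ]
  ring

/-- Inclusion-exclusion for triangles in terms of the missing edges. -/
theorem triSum_eq_missing [DecidableEq V] (h : IsAdj a) (N : Finset V) :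
    triSum N a = #N * (#N - 1) * (#N - 2)
      - 3 * (#N - 1) * ∑ x ∈ N, ∑ y ∈ N, _root_.missing a x y
      + 3 * ∑ x ∈ N, (∑ y ∈ N, _root_.missing a x y) ^ 2 - triSum N (_root_.missing a) := by
  set M := _root_.missing a with hM
  have hMa : IsAdj M := h.missing
  -- This expands the product of the factors 1 - [x = y] - M x y. Mixed terms collapse because M
  -- vanishes on the diagonal and its values are idempotent.
  have e : ∀ x y z, a x y * a y z * a x z = 1 - (if x = y then 1 else 0)
      - (if y = z then 1 else 0) - (if x = z then 1 else 0)
      + 2 * (if x = y then if y = z then 1 else 0 else 0)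
      - M x y - M y z - M x z + M x y * M x z + M x y * M y z + M x z * M y z
      + (if x = y then M x z else 0) + (if y = z then M x y else 0) + (if x = z then M x y else 0)
      - M x y * M y z * M x z := by
    intro x y z
    by_cases hxy : x = y
    · subst hxy
      by_cases hxz : x = z
      · subst hxz; simp [h.diag, hMa.diag]
      · have := hMa.sq x z
        simp only [h.diag, hMa.diag, hxz, if_true, if_false, this]; ring
    · by_cases hxz : x = z
      · subst hxz
        have := hMa.sq x y
        simp only [h.diag, hMa.diag, hxy, hMa.symm y x, if_true, if_false, Ne.symm hxy, this]; ring
      · by_cases hyz : y = z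
        · subst hyz
          have := hMa.sq x y
          simp only [h.diag, hMa.diag, hxy, if_true, if_false, this]; ring
        · rw [hM, missing_of_ne hxy, missing_of_ne hxz, missing_of_ne hyz]
          simp only [hxy, hxz, hyz, if_false]
          ring
  have q1 : ∑ x ∈ N, ∑ y ∈ N, ∑ z ∈ N, M x y * M x z = ∑ x ∈ N, (∑ y ∈ N, M x y) ^ 2 := by
    simp only [← Finset.mul_sum]; exact sum_mul_deg_left M N
  have q2 : ∑ x ∈ N, ∑ y ∈ N, ∑ z ∈ N, M x y * M y z = ∑ x ∈ N, (∑ y ∈ N, M x y) ^ 2 := by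
    simp only [← Finset.mul_sum]; exact hMa.sum_mul_deg N
  have q3 : ∑ x ∈ N, ∑ y ∈ N, ∑ z ∈ N, M x z * M y z = ∑ x ∈ N, (∑ y ∈ N, M x y) ^ 2 := by
    rw [← q2]
    refine Finset.sum_congr rfl fun x _ => ?_
    rw [Finset.sum_comm]
    exact Finset.sum_congr rfl fun y _ => Finset.sum_congr rfl fun z _ => by rw [hMa.symm z y]
  have q4 : ∑ x ∈ N, ∑ y ∈ N, ∑ z ∈ N, (if x = y then M x z else 0)
      = ∑ x ∈ N, ∑ y ∈ N, M x y := by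
    refine Finset.sum_congr rfl fun x hx => ?_
    rw [Finset.sum_comm]
    simp [hx]
  have q5 : ∑ x ∈ N, ∑ y ∈ N, ∑ z ∈ N, (if y = z then M x y else 0)
      = ∑ x ∈ N, ∑ y ∈ N, M x y :=
    Finset.sum_congr rfl fun x hx => Finset.sum_congr rfl fun y hy => by simp [hy]
  have q6 : ∑ x ∈ N, ∑ y ∈ N, ∑ z ∈ N, (if x = z then M x y else 0)
      = ∑ x ∈ N, ∑ y ∈ N, M x y :=
    Finset.sum_congr rfl fun x hx => Finset.sum_congr rfl fun y hy => by simp [hx]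
  have c1 : ∑ x ∈ N, ∑ y ∈ N, ∑ z ∈ N, (if x = y then (1 : ℤ) else 0) = #N * #N := by
    have : ∀ x ∈ N, ∑ y ∈ N, ∑ z ∈ N, (if x = y then (1 : ℤ) else 0) = #N := by
      intro x hx
      rw [Finset.sum_comm]
      simp [hx]
    rw [Finset.sum_congr rfl this]; simp
  have c2 : ∑ x ∈ N, ∑ y ∈ N, ∑ z ∈ N, (if y = z then (1 : ℤ) else 0) = #N * #N := by
    have : ∀ y ∈ N, ∑ z ∈ N, (if y = z then (1 : ℤ) else 0) = 1 := by
      intro y hy; simp [hy]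
    rw [Finset.sum_congr rfl fun x _ => Finset.sum_congr rfl this]; simp
  have c3 : ∑ x ∈ N, ∑ y ∈ N, ∑ z ∈ N, (if x = z then (1 : ℤ) else 0) = #N * #N := by
    have : ∀ x ∈ N, ∑ z ∈ N, (if x = z then (1 : ℤ) else 0) = 1 := by
      intro y hy; simp [hy]
    rw [Finset.sum_congr rfl fun x hx => Finset.sum_congr rfl fun y _ => this x hx]; simp
  have c4 : ∑ x ∈ N, ∑ y ∈ N, ∑ z ∈ N, (if x = y then if y = z then (1 : ℤ) else 0 else 0)
      = #N := by
    have : ∀ x ∈ N, ∑ y ∈ N, ∑ z ∈ N, (if x = y then if y = z then (1 : ℤ) else 0 else 0)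
        = 1 := by
      intro x hx
      rw [Finset.sum_comm]
      simp [hx]
    rw [Finset.sum_congr rfl this]; simp
  have m1 : ∑ x ∈ N, ∑ y ∈ N, ∑ z ∈ N, M x y = #N * ∑ x ∈ N, ∑ y ∈ N, M x y := by
    simp [Finset.mul_sum]
  have m2 : ∑ x ∈ N, ∑ y ∈ N, ∑ z ∈ N, M y z = #N * ∑ x ∈ N, ∑ y ∈ N, M x y := by simp
  have m3 : ∑ x ∈ N, ∑ y ∈ N, ∑ z ∈ N, M x z = #N * ∑ x ∈ N, ∑ y ∈ N, M x y := by
    simp [Finset.mul_sum]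
  have c0 : ∑ x ∈ N, ∑ y ∈ N, ∑ z ∈ N, (1 : ℤ) = #N * (#N * #N) := by simp
  unfold triSum
  simp only [e, Finset.sum_add_distrib, Finset.sum_sub_distrib, ← Finset.mul_sum (a := (2 : ℤ))]
  rw [q1, q2, q3, q4, q5, q6, c0, c1, c2, c3, c4, m1, m2, m3]
  ring

end IsAdj

end

/-! ### The loss caused by deleting a closed neighbourhood -/

section

variable {V : Type*} {a : V → V → ℤ}

namespace IsAdj

/-- A triangle at x uses an ordered pair of distinct neighbours; their adjacency is dropped. -/
theorem out_deg_sq [DecidableEq V] (h : IsAdj a) (A : Finset V) (x : V) :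
    ∑ y ∈ A, ∑ z ∈ A, a x y * a y z * a x z ≤ (∑ y ∈ A, a x y) ^ 2 - ∑ y ∈ A, a x y := by
  have e : ∀ y z, a x y * a y z * a x z ≤ a x y * a x z - if y = z then a x y else 0 := by
    intro y z
    split_ifs with hyz
    · subst hyz; simp [h.diag, h.sq]
    · have := h.le_one y z
      have := mul_nonneg (h.nonneg x y) (h.nonneg x z)
      nlinarith
  refine (Finset.sum_le_sum fun y _ => Finset.sum_le_sum fun z _ => e y z).trans (le_of_eq ?_)
  simp only [Finset.sum_sub_distrib, ← Finset.mul_sum, ← Finset.sum_mul]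
  rw [_root_.sq]
  congr 1
  exact Finset.sum_congr rfl fun y hy => by simp [hy]

/-- The effect of deleting all edges that meet a set `T ∪ S` of `r + 1` vertices, where `T` is
joined completely to `T ∪ S` and to nothing else, and all degrees are at most `r`. -/
theorem deleteMeeting_bound [Fintype V] [DecidableEq V] (h : IsAdj a) {r : ℕ} {T S : Finset V}
    (hTS : Disjoint T S) (hcard : #T + #S = r + 1)
    (hin : ∀ x ∈ T, ∀ y ∈ T ∪ S, x ≠ y → a x y = 1) (hout : ∀ x ∈ T, ∀ y ∈ (T ∪ S)ᶜ, a x y = 0)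
    (hdeg : ∀ x, ∑ y, a x y ≤ r) :
    ∃ O : ℤ, 0 ≤ O ∧ O ≤ ∑ x ∈ S, ∑ y ∈ S, _root_.missing a x y ∧
      ∑ x, ∑ y, a x y = ∑ x, ∑ y, _root_.deleteMeeting (T ∪ S) a x y + (r + 1) * r
        - ∑ x ∈ S, ∑ y ∈ S, _root_.missing a x y + 2 * O ∧
      triSum univ a ≤ triSum univ (_root_.deleteMeeting (T ∪ S) a) + (r + 1) * r * (r - 1)
        - 3 * r * ∑ x ∈ S, ∑ y ∈ S, _root_.missing a x y
        + 3 * ∑ x ∈ S, (∑ y ∈ S, _root_.missing a x y) ^ 2 - triSum S (_root_.missing a)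
        + 3 * (#S - 2) * O := by
  set N := T ∪ S with hN
  set M := _root_.missing a with hM
  have hMa : IsAdj M := h.missing
  have hNcard : (#N : ℤ) = r + 1 := by
    rw [hN, Finset.card_union_of_disjoint hTS]; exact_mod_cast hcard
  have hM0 : ∀ x ∈ T, ∀ y ∈ N, M x y = 0 := by
    intro x hx y hy
    by_cases hxy : x = y
    · subst hxy; exact hMa.diag x
    · rw [hM, missing_of_ne hxy, hin x hx y hy hxy, sub_self]
  have hSN : ∀ x ∈ S, x ∈ N := fun x hx => Finset.mem_union_right _ hx
  have hTN : ∀ x ∈ T, x ∈ N := fun x hx => Finset.mem_union_left _ hx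
  have degS : ∀ x ∈ N, ∑ y ∈ N, M x y = ∑ y ∈ S, M x y := by
    intro x hx
    rw [hN, Finset.sum_union hTS,
      Finset.sum_eq_zero fun y hy => by rw [hMa.symm, hM0 y hy x hx], zero_add]
  have degT : ∀ x ∈ T, ∑ y ∈ S, M x y = 0 := fun x hx =>
    Finset.sum_eq_zero fun y hy => hM0 x hx y (hSN y hy)
  have sumM : ∑ x ∈ N, ∑ y ∈ N, M x y = ∑ x ∈ S, ∑ y ∈ S, M x y := by
    rw [Finset.sum_congr rfl degS, hN, Finset.sum_union hTS, Finset.sum_eq_zero degT, zero_add]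
  have sumsqM : ∑ x ∈ N, (∑ y ∈ N, M x y) ^ 2 = ∑ x ∈ S, (∑ y ∈ S, M x y) ^ 2 := by
    rw [Finset.sum_congr rfl fun x hx => by rw [degS x hx], hN, Finset.sum_union hTS,
      Finset.sum_eq_zero fun x hx => by rw [degT x hx]; rfl, zero_add]
  have triM : triSum N M = triSum S M := by
    unfold triSum
    have z1 : ∀ x ∈ N, ∀ y ∈ N, ∑ z ∈ N, M x y * M y z * M x z
        = ∑ z ∈ S, M x y * M y z * M x z := by
      intro x hx y hy
      rw [hN, Finset.sum_union hTS, Finset.sum_eq_zero fun z hz => by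
        rw [hMa.symm x z, hM0 z hz x hx, mul_zero], zero_add]
    have z2 : ∀ x ∈ N, ∑ y ∈ N, ∑ z ∈ S, M x y * M y z * M x z
        = ∑ y ∈ S, ∑ z ∈ S, M x y * M y z * M x z := by
      intro x hx
      rw [hN, Finset.sum_union hTS, Finset.sum_eq_zero fun y hy =>
        Finset.sum_eq_zero fun z hz => by
          rw [hMa.symm x y, hM0 y hy x hx, zero_mul, zero_mul], zero_add]
    rw [Finset.sum_congr rfl fun x hx => Finset.sum_congr rfl (z1 x hx), Finset.sum_congr rfl z2,
      hN, Finset.sum_union hTS, Finset.sum_eq_zero fun x hx =>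
        Finset.sum_eq_zero fun y hy => Finset.sum_eq_zero fun z hz => by
          rw [hM0 x hx y (hSN y hy), zero_mul, zero_mul], zero_add]
  set o : V → ℤ := fun x => ∑ y ∈ Nᶜ, a x y with ho
  have o0 : ∀ x, 0 ≤ o x := fun x => Finset.sum_nonneg fun y _ => h.nonneg x y
  have oT : ∀ x ∈ T, o x = 0 := fun x hx => Finset.sum_eq_zero fun y hy => hout x hx y hy
  -- N offers x exactly r possible neighbours, so each edge from x out of N is paid for by a missing
  -- edge at x.
  have oM : ∀ x ∈ S, o x ≤ ∑ y ∈ S, M x y := by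
    intro x hx
    have h1 := hdeg x
    rw [← Finset.sum_add_sum_compl N] at h1
    have h2 := IsAdj.deg_missing a N (hSN x hx)
    rw [← hM, degS x (hSN x hx)] at h2
    have : o x = ∑ y ∈ Nᶜ, a x y := rfl
    linarith
  have sumo : ∑ x ∈ N, o x = ∑ x ∈ S, o x := by
    rw [hN, Finset.sum_union hTS, Finset.sum_eq_zero oT, zero_add]
  have sumN : ∑ x ∈ N, ∑ y ∈ N, a x y = (r + 1) * r - ∑ x ∈ S, ∑ y ∈ S, M x y := by
    have := Finset.sum_congr rfl fun x (hx : x ∈ N) => IsAdj.deg_missing a N hx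
    rw [← hM, sumM, Finset.sum_sub_distrib, Finset.sum_const, nsmul_eq_mul, hNcard] at this
    linarith
  have nnc : ∑ x ∈ N, ∑ y ∈ N, ∑ z ∈ Nᶜ, a x y * a y z * a x z
      ≤ ∑ x ∈ S, o x * (#S - 1 - ∑ y ∈ S, M x y) := by
    have hT0 : ∀ x ∈ T, ∀ z ∈ Nᶜ, a x z = 0 := hout
    have e1 : ∑ x ∈ N, ∑ y ∈ N, ∑ z ∈ Nᶜ, a x y * a y z * a x z
        = ∑ x ∈ S, ∑ y ∈ S, ∑ z ∈ Nᶜ, a x y * a y z * a x z := by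
      have z2 : ∀ x ∈ N, ∑ y ∈ N, ∑ z ∈ Nᶜ, a x y * a y z * a x z
          = ∑ y ∈ S, ∑ z ∈ Nᶜ, a x y * a y z * a x z := by
        intro x hx
        conv_lhs => rw [hN, Finset.sum_union hTS]
        rw [Finset.sum_eq_zero (s := T) fun y hy => Finset.sum_eq_zero fun z hz => by
          rw [hT0 y hy z hz, mul_zero, zero_mul], zero_add]
      rw [Finset.sum_congr rfl z2]
      conv_lhs => rw [hN, Finset.sum_union hTS]
      rw [Finset.sum_eq_zero (s := T) fun x hx => Finset.sum_eq_zero fun y hy =>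
        Finset.sum_eq_zero fun z hz => by rw [hT0 x hx z hz, mul_zero], zero_add]
    rw [e1]
    refine Finset.sum_le_sum fun x hx => ?_
    have h2 := IsAdj.deg_missing a S hx
    rw [← hM] at h2
    have : (#S : ℤ) - 1 - ∑ y ∈ S, M x y = ∑ y ∈ S, a x y := by linarith
    rw [this, ho, Finset.sum_mul_sum, Finset.sum_comm]
    refine Finset.sum_le_sum fun z _ => Finset.sum_le_sum fun y _ => ?_
    have := h.le_one y z
    have := mul_nonneg (h.nonneg x y) (h.nonneg x z)
    nlinarith
  have ncc : ∑ x ∈ N, ∑ y ∈ Nᶜ, ∑ z ∈ Nᶜ, a x y * a y z * a x z ≤ ∑ x ∈ S, (o x ^ 2 - o x) := by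
    have e1 : ∑ x ∈ N, (o x ^ 2 - o x) = ∑ x ∈ S, (o x ^ 2 - o x) := by
      conv_lhs => rw [hN, Finset.sum_union hTS]
      rw [Finset.sum_eq_zero (s := T) fun x hx => by rw [oT x hx]; rfl, zero_add]
    rw [← e1]
    exact Finset.sum_le_sum fun x _ => h.out_deg_sq _ x
  -- The two bounds add up at x to o(x) times #S - 2 - d_M(x) + o(x), and o(x) ≤ d_M(x).
  have tot : ∑ x ∈ S, o x * (#S - 1 - ∑ y ∈ S, M x y) + ∑ x ∈ S, (o x ^ 2 - o x)
      ≤ (#S - 2) * ∑ x ∈ S, o x := by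
    rw [← Finset.sum_add_distrib, Finset.mul_sum]
    refine Finset.sum_le_sum fun x hx => ?_
    nlinarith [oM x hx, o0 x]
  refine ⟨∑ x ∈ S, o x, Finset.sum_nonneg fun x _ => o0 x, Finset.sum_le_sum oM, ?_, ?_⟩
  · rw [h.sum_univ_eq N, sumN, ← sumo]; ring
  · rw [h.triSum_univ_eq N, h.triSum_eq_missing N, ← hM, sumM, sumsqM, triM, hNcard]
    linarith

end IsAdj

end

/-! ### The extremal numbers and their finite checks -/

/-- The smaller element of the `x`-th pair of natural numbers in colexicographic order. -/
def colexMin (x : ℕ) : ℕ :=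
  x - (Nat.findGreatest (fun j => j.choose 2 ≤ x) (x + 1)).choose 2

/-- The number of triangles of the colex graph with `b` edges. -/
def colexTri (b : ℕ) : ℕ := ∑ x ∈ Finset.range b, colexMin x

/-- The number of triangles of `aK_{r+1} ∪ C(b)`, where `m = a * (r + 1).choose 2 + b`. -/
def triBound (r m : ℕ) : ℕ :=
  m / (r + 1).choose 2 * (r + 1).choose 3 + colexTri (m % (r + 1).choose 2)

/-- The values of `colexTri` below `36`. -/
def colexTriTable (b : ℕ) : ℕ :=
  [0, 0, 0, 1, 1, 2, 4, 4, 5, 7, 10, 10, 11, 13, 16, 20, 20, 21, 23, 26, 30, 35, 35, 36, 38, 41,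
    45, 50, 56, 56, 57, 59, 62, 66, 71, 77].getD b 0

theorem colexTri_succ (b : ℕ) : colexTri (b + 1) = colexTri b + colexMin b :=
  Finset.sum_range_succ _ _

theorem colexTri_eq_table {b : ℕ} (hb : b < 36) : colexTri b = colexTriTable b := by
  have step : ∀ b < 35, colexTriTable (b + 1) = colexTriTable b + colexMin b := by decide +kernel
  induction b with
  | zero => rfl
  | succ b ih => rw [colexTri_succ, ih (by omega), step b (by omega)]

/-- `triBound` computed by table lookup. -/
def triBoundTable (r m : ℕ) : ℕ :=
  m / (r + 1).choose 2 * (r + 1).choose 3 + colexTriTable (m % (r + 1).choose 2)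

theorem choose_two_bounds {r : ℕ} (h1 : 1 ≤ r) (hr : r ≤ 8) :
    0 < (r + 1).choose 2 ∧ (r + 1).choose 2 ≤ 36 := by
  interval_cases r <;> decide

theorem triBound_eq_table {r : ℕ} (h1 : 1 ≤ r) (hr : r ≤ 8) (m : ℕ) :
    triBound r m = triBoundTable r m := by
  obtain ⟨h2, h3⟩ := choose_two_bounds h1 hr
  rw [triBound, triBoundTable, colexTri_eq_table ((Nat.mod_lt _ h2).trans_le h3)]

theorem triBoundTable_mul_add {r : ℕ} (h : 0 < (r + 1).choose 2) (q u : ℕ) :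
    triBoundTable r ((r + 1).choose 2 * q + u) = q * (r + 1).choose 3 + triBoundTable r u := by
  rw [triBoundTable, triBoundTable, Nat.mul_add_div h, Nat.mul_add_mod]; ring

theorem triBoundTable_add_lt : ∀ r < 9, ∀ u < (r + 1).choose 2, ∀ v < (r + 1).choose 2,
    triBoundTable r u + triBoundTable r v ≤ triBoundTable r (u + v) := by
  decide +kernel

/-- Full multiples of C(r+1,2) contribute additively, so only the remainders matter, and these are
finitely many. -/
theorem triBound_add_le {r : ℕ} (h1 : 1 ≤ r) (hr : r ≤ 8) (x y : ℕ) :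
    triBound r x + triBound r y ≤ triBound r (x + y) := by
  have hB := (choose_two_bounds h1 hr).1
  simp only [triBound_eq_table h1 hr]
  have key := triBoundTable_add_lt r (by omega) _ (Nat.mod_lt x hB) _ (Nat.mod_lt y hB)
  set B := (r + 1).choose 2 with hBdef
  have e : x + y = B * (x / B + y / B) + (x % B + y % B) := by
    have := Nat.div_add_mod x B
    have := Nat.div_add_mod y B
    rw [mul_add]; omega
  rw [e, triBoundTable_mul_add hB]
  conv_lhs => rw [← Nat.div_add_mod x B, ← Nat.div_add_mod y B, triBoundTable_mul_add hB,
    triBoundTable_mul_add hB]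
  rw [add_mul]; omega

/-- This is the numerical step for removing a vertex of degree d, which destroys at most C(d,2)
triangles. The condition on d holds for a least positive degree, and it forces d < 8. -/
theorem colexTri_min_degree {m d : ℕ} (hm : m < 36) (hd : d * (d + 1) ≤ 2 * m) :
    3 * (d * (d - 1)) + 6 * colexTri (m - d) ≤ 6 * colexTri m := by
  have h : ∀ m < 36, ∀ d < 8, d * (d + 1) ≤ 2 * m →
    3 * (d * (d - 1)) + 6 * colexTriTable (m - d) ≤ 6 * colexTriTable m := by decide +kernel
  rw [colexTri_eq_table hm, colexTri_eq_table (by omega)]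
  exact h m hm d (by by_contra! h'; nlinarith) hd

theorem triBound_eq_colexTri {r m : ℕ} (h : m < (r + 1).choose 2) : triBound r m = colexTri m := by
  rw [triBound, Nat.div_eq_of_lt h, Nat.mod_eq_of_lt h, zero_mul, zero_add]

/-- This serves graphs without tight edges: m(r-2) ≤ 3 `triBound r m` + 2, written without
subtraction. One clique plus a remainder is checked; each further clique helps, since three times
its triangle count is r-1 times its edge count. -/
theorem triBound_ge {r m : ℕ} (h1 : 1 ≤ r) (hr : r ≤ 7) (hm : (r + 1).choose 2 ≤ m) :
    r * m ≤ 3 * triBound r m + 2 + 2 * m := by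
  have h : ∀ r < 8, ∀ u < (r + 1).choose 2, r * ((r + 1).choose 2 + u) ≤
    3 * ((r + 1).choose 3 + triBoundTable r u) + 2 + 2 * ((r + 1).choose 2 + u) := by decide +kernel
  have h' : ∀ r < 8, r * (r + 1).choose 2 ≤ 3 * (r + 1).choose 3 + 2 * (r + 1).choose 2 := by
    decide +kernel
  have hB := (choose_two_bounds h1 (by omega)).1
  rw [triBound_eq_table h1 (by omega)]
  set B := (r + 1).choose 2
  have hq : 1 ≤ m / B := (Nat.one_le_div_iff hB).2 hm
  obtain ⟨q, hq⟩ := Nat.exists_eq_add_of_le hq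
  have h2 := h r (by omega) _ (Nat.mod_lt m hB)
  have h3 := Nat.mul_le_mul_left q (h' r (by omega))
  have h4 := Nat.div_add_mod m B
  rw [← h4, triBoundTable_mul_add hB, hq]
  nlinarith

theorem triBound_eight_ge {m : ℕ} (hm : 36 ≤ m) : 2 * m ≤ triBound 8 m + 1 := by
  have h : ∀ u < 36, 2 * (36 + u) ≤ 84 + triBoundTable 8 u + 1 := by decide +kernel
  have e : (8 + 1).choose 2 = 36 := rfl
  have e' : (8 + 1).choose 3 = 84 := rfl
  rw [triBound_eq_table (by omega) le_rfl]
  have h2 := h _ (Nat.mod_lt m (by norm_num))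
  conv_rhs => rw [← Nat.div_add_mod m 36, ← e, triBoundTable_mul_add (by decide), e, e']
  omega

/-- From 72 edges on, a second K_9, with 84 triangles on 36 edges, makes up the deficit of one in
`triBound_eight_ge`; below 72 the comparison of r = 7 with r = 8 is a finite check. -/
theorem triBound_eight_ge' (m : ℕ) : 2 * m ≤ triBound 8 m ∨
    triBound 7 m ≤ triBound 8 m := by
  rcases lt_or_ge m 72 with h1 | h1
  · right
    have h : ∀ m < 72, triBoundTable 7 m ≤ triBoundTable 8 m := by decide +kernel
    rw [triBound_eq_table (by omega) le_rfl, triBound_eq_table (by omega) (by omega)]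
    exact h m h1
  · left
    have h : ∀ u < 36, 2 * (36 + u) ≤ 84 + triBoundTable 8 u + 1 := by decide +kernel
    have e : (8 + 1).choose 2 = 36 := rfl
    have e' : (8 + 1).choose 3 = 84 := rfl
    rw [triBound_eq_table (by omega) le_rfl]
    have h2 := h _ (Nat.mod_lt m (by norm_num))
    conv_rhs => rw [← Nat.div_add_mod m 36, ← e, triBoundTable_mul_add (by decide), e, e']
    omega

/-- The constants come from `deleteMeeting_bound` with r = 8 and a perfect matching missing on 8
vertices: 504 - 192 + 24 = 336 ordered triangles, and 36 - 4 = 32 edges before those leaving N are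
counted. -/
theorem triBound_matching {O : ℤ} (h0 : 0 ≤ O) (h8 : O ≤ 8) {e : ℕ} (he : (e : ℤ) = 32 + O) :
    336 + 18 * O ≤ 6 * triBound 8 e := by
  rw [triBound_eq_table (by omega) le_rfl]
  have h : ∀ o < 9, 336 + 18 * o ≤ 6 * triBoundTable 8 (32 + o) := by decide +kernel
  have := h O.toNat (by omega)
  have e1 : e = 32 + O.toNat := by omega
  rw [e1]
  omega

/-- A check of the bounds on the number of triangles that are lost when the edges meeting the
closed neighbourhood of a tight edge are deleted. -/
theorem triBoundTable_tight : ∀ j < 7, ∀ p ≤ (j + 1).choose 2, ∀ o ≤ 2 * p,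
    min ((j + 3) * (j + 2) * (j + 1)
          + 3 * min (p * (p + 1)) ((4 * p * p + 2 * p * j ^ 2) / (2 * j + 1)) + 3 * (j + 1) * o)
        ((j + 3) * (j + 2) * (j + 1)
          + min (p * (p + 1)) ((4 * p * p + 2 * p * j ^ 2) / (2 * j + 1))
          + 2 * (j + 1) * p + 3 * (j + 1) * o)
      < 6 * triBoundTable (j + 2) ((j + 3).choose 2 + o - p) + 6 + 6 * (j + 2) * p + 6 * o := by
  decide +kernel

/-- Here r = j + 2 and the missing graph lives on the j + 1 common neighbours: P is its degree sum,
Q its sum of squared degrees, K its ordered triangle count. Divisibility by 6 permits an error below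
6. -/
theorem triBound_tight {j : ℕ} (hj : j < 7) {P Q K O t : ℤ} {e : ℕ} (hP : P ≤ (j + 1) * j)
    (hQ : 4 * Q ≤ P * (P + 2)) (hQ' : (2 * j + 1) * Q ≤ P ^ 2 + P * j ^ 2) (hK : 0 ≤ K)
    (hK' : 2 * Q - (j + 1) * P ≤ K) (hO : 0 ≤ O) (hOP : O ≤ P)
    (he : 2 * (e : ℤ) = (j + 3) * (j + 2) - P + 2 * O)
    (ht : t ≤ (j + 3) * (j + 2) * (j + 1) - 3 * (j + 2) * P + 3 * Q - K + 3 * (j - 1) * O)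
    (hdvd : 6 ∣ t) : t ≤ 6 * triBound (j + 2) e := by
  rw [triBound_eq_table (by omega) (by omega)]
  have choose_eq : ∀ n : ℕ, ((n + 1).choose 2 : ℤ) * 2 = (n + 1) * n := fun n => by
    have := Nat.add_one_mul_choose_eq n 1
    rw [Nat.choose_one_right] at this
    exact_mod_cast this.symm
  have hc := choose_eq (j + 2)
  have hc' := choose_eq j
  push_cast at hc
  obtain ⟨p, hp⟩ : ∃ p : ℕ, P = 2 * p := ⟨(P / 2).toNat, by
    have : (j + 2 + 1 : ℤ) * (j + 2) = (j + 3) * (j + 2) := by ring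
    rw [this] at hc
    omega⟩
  obtain ⟨o, rfl⟩ : ∃ o : ℕ, O = o := ⟨O.toNat, by omega⟩
  have hpc : p ≤ (j + 1).choose 2 := by zify; linarith
  have key := triBoundTable_tight j hj p hpc o (by omega)
  have hee : e = (j + 3).choose 2 + o - p := by
    have : ((j + 2 + 1).choose 2 : ℤ) = (j + 3).choose 2 := rfl
    have : (j + 2 + 1 : ℤ) * (j + 2) = (j + 3) * (j + 2) := by ring
    omega
  rw [← hee] at key
  have hQm : Q ≤ (min (p * (p + 1)) ((4 * p * p + 2 * p * j ^ 2) / (2 * j + 1)) : ℕ) := by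
    push_cast
    refine le_min ?_ ?_
    · rw [hp] at hQ; linarith
    · rw [Int.le_ediv_iff_mul_le (by positivity)]
      rw [hp] at hQ'; linarith
  generalize min (p * (p + 1)) ((4 * p * p + 2 * p * j ^ 2) / (2 * j + 1)) = m at key hQm
  obtain ⟨t', rfl⟩ := hdvd
  rw [hp] at ht hK'
  -- The first alternative uses K ≥ 0, the second Goodman's lower bound for K.
  rcases min_lt_iff.1 key with h | h <;> zify at h
  · have : 6 * t' < 6 * (triBoundTable (j + 2) e : ℤ) + 6 := by linarith
    omega
  · have : 6 * t' < 6 * (triBoundTable (j + 2) e : ℤ) + 6 := by linarith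
    omega

/-! ### Kruskal-Katona below 36 edges, codegrees, and the induction -/

section

variable {V : Type*} {a : V → V → ℤ}

namespace IsAdj

theorem sum_insert [DecidableEq V] (h : IsAdj a) {S : Finset V} {v : V} (hv : v ∉ S) :
    ∑ x ∈ insert v S, ∑ y ∈ insert v S, a x y
      = ∑ x ∈ S, ∑ y ∈ S, a x y + 2 * ∑ y ∈ S, a y v := by
  simp only [Finset.sum_insert hv, Finset.sum_add_distrib, h.diag]
  rw [Finset.sum_congr rfl fun x _ => h.symm v x]
  ring

theorem triSum_insert [DecidableEq V] (h : IsAdj a) {S : Finset V} {v : V} (hv : v ∉ S) :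
    triSum (insert v S) a = triSum S a + 3 * ∑ y ∈ S, ∑ z ∈ S, a v y * a y z * a v z := by
  have e1 : ∑ x ∈ S, ∑ y ∈ S, a x y * a y v * a x v
      = ∑ y ∈ S, ∑ z ∈ S, a v y * a y z * a v z :=
    Finset.sum_congr rfl fun x _ => Finset.sum_congr rfl fun y _ => by
      rw [h.symm y v, h.symm x v]; ring
  have e2 : ∑ x ∈ S, ∑ z ∈ S, a x v * a v z * a x z
      = ∑ y ∈ S, ∑ z ∈ S, a v y * a y z * a v z :=
    Finset.sum_congr rfl fun x _ => Finset.sum_congr rfl fun y _ => by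
      rw [h.symm x v]; ring
  simp only [triSum, Finset.sum_insert hv, Finset.sum_add_distrib, h.diag, e1, e2]
  simp
  ring

/-- The adjacency function of the neighbourhood of `v`. -/
theorem neighborhood (h : IsAdj a) (v : V) : IsAdj fun y z => a v y * a y z * a v z := by
  refine ⟨fun y z => ?_, fun y z => ?_, fun y => by simp [h.diag]⟩
  · rcases h.zero_or_one v y with h1 | h1 <;> rcases h.zero_or_one y z with h2 | h2 <;>
      rcases h.zero_or_one v z with h3 | h3 <;> simp [h1, h2, h3]
  · simp only [h.symm y z]; ring

/-- A new vertex v adds three times the ordered edge count of its neighbourhood, which is even. This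
supplies the rounding in the later estimates. -/
theorem six_dvd_triSum (h : IsAdj a) (S : Finset V) : 6 ∣ triSum S a := by
  classical
  induction S using Finset.induction_on with
  | empty => simp [triSum]
  | insert v S hv ih =>
    obtain ⟨k, hk⟩ := (h.neighborhood v).even_sum S
    rw [h.triSum_insert hv, hk]
    exact dvd_add ih ⟨k, by ring⟩

theorem deleteMeeting_le [DecidableEq V] (h : IsAdj a) (N : Finset V) (x y : V) :
    _root_.deleteMeeting N a x y ≤ a x y := by
  unfold _root_.deleteMeeting
  split_ifs
  · exact h.nonneg x y
  · exact le_rfl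

theorem exists_two_mul [Fintype V] (h : IsAdj a) : ∃ m : ℕ, ∑ x, ∑ y, a x y = 2 * m := by
  obtain ⟨k, hk⟩ := h.even_sum univ
  have : 0 ≤ ∑ x, ∑ y, a x y := Finset.sum_nonneg fun x _ => Finset.sum_nonneg fun y _ => h.nonneg x y
  exact ⟨k.toNat, by omega⟩

/-- The Kruskal-Katona bound for triangles in graphs with fewer than `36` edges. -/
theorem triSum_le_colexTri [Fintype V] {m : ℕ} (hm : m < 36) (h : IsAdj a)
    (hsum : ∑ x, ∑ y, a x y = 2 * m) : triSum univ a ≤ 6 * colexTri m := by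
  classical
  induction m using Nat.strong_induction_on generalizing a with
  | _ m ih =>
  by_cases h0 : ∀ x, ∑ y, a x y = 0
  · have hz : ∀ x y, a x y = 0 := fun x y =>
      (Finset.sum_eq_zero_iff_of_nonneg fun y _ => h.nonneg x y).1 (h0 x) y (mem_univ y)
    have : triSum univ a = 0 := by simp [triSum, hz]
    rw [this]; positivity
  push Not at h0
  obtain ⟨u, hu⟩ := h0
  obtain ⟨v, hv, hmin⟩ := Finset.exists_min_image ({x | ∑ y, a x y ≠ 0} : Finset V)
    (fun x => ∑ y, a x y) ⟨u, by simpa using hu⟩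
  have hd0 : 0 ≤ ∑ y, a v y := Finset.sum_nonneg fun y _ => h.nonneg v y
  obtain ⟨d, hd⟩ : ∃ d : ℕ, ∑ y, a v y = d := ⟨(∑ y, a v y).toNat, by omega⟩
  have hdpos : d ≠ 0 := by
    rintro rfl
    exact (Finset.mem_filter.1 hv).2 (by simpa using hd)
  -- The vertex v and its d neighbours all have degree at least d.
  have hdm : d * (d + 1) ≤ 2 * m := by
    have h1 : ∀ y ∈ univ.erase v, a v y * d ≤ ∑ z, a y z := by
      intro y _
      rcases h.zero_or_one v y with h1 | h1
      · rw [h1, zero_mul]; exact Finset.sum_nonneg fun z _ => h.nonneg y z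
      · rw [h1, one_mul, ← hd]
        refine hmin y (Finset.mem_filter.2 ⟨mem_univ y, ?_⟩)
        have := Finset.single_le_sum (fun z _ => h.nonneg y z) (mem_univ v)
        rw [h.symm y v, h1] at this
        omega
    have h2 := Finset.sum_le_sum h1
    rw [← Finset.sum_mul] at h2
    have h3 := Finset.add_sum_erase univ (fun y => a v y) (mem_univ v)
    have h4 := Finset.add_sum_erase univ (fun x => ∑ y, a x y) (mem_univ v)
    simp only [h.diag, zero_add] at h3 h4
    rw [h3, hd] at h2
    rw [hsum, hd] at h4
    zify
    nlinarith
  have hcompl : ∑ y ∈ ({v} : Finset V)ᶜ, a v y = d := by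
    have := Finset.sum_add_sum_compl ({v} : Finset V) fun y => a v y
    rw [Finset.sum_singleton, h.diag, zero_add] at this
    rw [this, hd]
  have e1 := h.sum_univ_eq {v}
  have e2 := h.triSum_univ_eq {v}
  simp only [Finset.sum_singleton, h.diag, triSum, hcompl, zero_mul, mul_zero,
    Finset.sum_const_zero, add_zero] at e1 e2
  obtain ⟨m', hm'⟩ := (h.deleteMeeting {v}).exists_two_mul
  have hmm : m' = m - d ∧ d ≤ m := by
    rw [hsum, hm'] at e1
    omega
  have h1 := ih m' (by omega) (by omega) (h.deleteMeeting {v}) hm'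
  have h2 := h.out_deg_sq {v}ᶜ v
  rw [hcompl] at h2
  have h3 := colexTri_min_degree hm hdm
  rw [← hmm.1] at h3
  have h4 : d * (d - 1) + d = d * d := by
    obtain ⟨k, rfl⟩ := Nat.exists_eq_succ_of_ne_zero hdpos
    simp only [Nat.succ_eq_add_one, Nat.add_sub_cancel]; ring
  zify at h3 h4
  unfold triSum at h1 ⊢
  rw [e2]
  nlinarith

theorem codeg_le [Fintype V] (h : IsAdj a) {r : ℤ} (hdeg : ∀ x, ∑ y, a x y ≤ r) {x y : V}
    (hxy : a x y = 1) : ∑ z, a x z * a y z ≤ r - 1 := by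
  classical
  have h1 := Finset.add_sum_erase univ (fun z => a x z) (mem_univ y)
  have h2 := Finset.add_sum_erase univ (fun z => a x z * a y z) (mem_univ y)
  have h3 : ∑ z ∈ univ.erase y, a x z * a y z ≤ ∑ z ∈ univ.erase y, a x z :=
    Finset.sum_le_sum fun z _ => by nlinarith [h.nonneg x z, h.le_one y z]
  simp only [h.diag, hxy] at h1 h2
  have := hdeg x
  linarith

/-- Besides y, the vertex x has at most r-1 neighbours, so r-1 common neighbours exhaust them. Used
in both directions, this shows that the ends of a tight edge have equal closed neighbourhoods. -/
theorem adj_of_tight [Fintype V] (h : IsAdj a) {r : ℤ} (hdeg : ∀ x, ∑ y, a x y ≤ r) {x y : V}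
    (hxy : a x y = 1) (ht : r - 1 ≤ ∑ z, a x z * a y z) {z : V} (hzy : z ≠ y)
    (hxz : a x z = 1) : a y z = 1 := by
  classical
  by_contra hyz
  replace hyz : a y z = 0 := (h.zero_or_one y z).resolve_right hyz
  have hz : z ∈ univ.erase y := Finset.mem_erase.2 ⟨hzy, mem_univ z⟩
  have h1 := Finset.add_sum_erase univ (fun z => a x z) (mem_univ y)
  have h2 := Finset.add_sum_erase univ (fun z => a x z * a y z) (mem_univ y)
  have h3 : ∑ z ∈ univ.erase y, a x z * a y z < ∑ z ∈ univ.erase y, a x z :=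
    Finset.sum_lt_sum (fun z _ => by nlinarith [h.nonneg x z, h.le_one y z])
      ⟨z, hz, by simp [hxz, hyz]⟩
  simp only [h.diag, hxy] at h1 h2
  have := hdeg x
  linarith

theorem card_filter_eq_sum (h : IsAdj a) (S : Finset V) (x : V) :
    (#{z ∈ S | a x z = 1} : ℤ) = ∑ z ∈ S, a x z := by
  rw [Finset.card_filter]
  push_cast
  refine Finset.sum_congr rfl fun z _ => ?_
  rcases h.zero_or_one x z with h | h <;> simp [h]

theorem triSum_eq_sum_codeg [Fintype V] (a : V → V → ℤ) :
    triSum univ a = ∑ x, ∑ y, a x y * ∑ z, a x z * a y z := by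
  unfold triSum
  simp only [Finset.mul_sum]
  exact Finset.sum_congr rfl fun x _ => Finset.sum_congr rfl fun y _ =>
    Finset.sum_congr rfl fun z _ => by ring

theorem triSum_le_of_codeg_le [Fintype V] (h : IsAdj a) {c : ℤ}
    (hc : ∀ x y, a x y = 1 → ∑ z, a x z * a y z ≤ c) :
    triSum univ a ≤ (∑ x, ∑ y, a x y) * c := by
  rw [triSum_eq_sum_codeg, Finset.sum_mul]
  refine Finset.sum_le_sum fun x _ => ?_
  rw [Finset.sum_mul]
  refine Finset.sum_le_sum fun y _ => ?_
  rcases h.zero_or_one x y with h1 | h1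
  · simp [h1]
  · rw [h1, one_mul, one_mul]; exact hc x y h1

theorem triSum_lt_of_codeg_lt [Fintype V] (h : IsAdj a) {c : ℤ}
    (hc : ∀ x y, a x y = 1 → ∑ z, a x z * a y z ≤ c) {x y : V} (hxy : a x y = 1)
    (hlt : ∑ z, a x z * a y z < c) :
    triSum univ a < (∑ x, ∑ y, a x y) * c := by
  have key : ∀ x y, a x y * ∑ z, a x z * a y z ≤ a x y * c := by
    intro x y
    rcases h.zero_or_one x y with h1 | h1
    · simp [h1]
    · rw [h1, one_mul, one_mul]; exact hc x y h1
  rw [triSum_eq_sum_codeg, Finset.sum_mul]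
  refine Finset.sum_lt_sum (fun x _ => ?_) ⟨x, mem_univ x, ?_⟩
  · rw [Finset.sum_mul]; exact Finset.sum_le_sum fun y _ => key x y
  · rw [Finset.sum_mul]
    exact Finset.sum_lt_sum (fun y _ => key x y) ⟨y, mem_univ y, by rwa [hxy, one_mul, one_mul]⟩

/-- If the deletion of the edges meeting `N` destroys at most as many triangles as the extremal
graph with that number of edges has, the bound for the remaining graph gives the bound. -/
theorem triSum_le_of_deleteMeeting [Fintype V] [DecidableEq V] (h : IsAdj a) {r m : ℕ}
    (h1 : 1 ≤ r) (hr : r ≤ 8) (hdeg : ∀ x, ∑ y, a x y ≤ r) (hsum : ∑ x, ∑ y, a x y = 2 * m)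
    (ih : ∀ m' < m, ∀ b : V → V → ℤ, IsAdj b → (∀ x, ∑ y, b x y ≤ r) → ∑ x, ∑ y, b x y = 2 * m' →
      triSum univ b ≤ 6 * triBound r m')
    (N : Finset V) (hlt : ∑ x, ∑ y, _root_.deleteMeeting N a x y < ∑ x, ∑ y, a x y)
    (ht : ∀ e : ℕ, ∑ x, ∑ y, a x y - ∑ x, ∑ y, _root_.deleteMeeting N a x y = 2 * e →
      6 ∣ triSum univ a - triSum univ (_root_.deleteMeeting N a) →
      triSum univ a - triSum univ (_root_.deleteMeeting N a) ≤ 6 * triBound r e) :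
    triSum univ a ≤ 6 * triBound r m := by
  obtain ⟨m', hm'⟩ := (h.deleteMeeting N).exists_two_mul
  have hmm : m' < m := by omega
  have h2 := ih m' hmm _ (h.deleteMeeting N)
    (fun x => (Finset.sum_le_sum fun y _ => h.deleteMeeting_le N x y).trans (hdeg x)) hm'
  have h3 := ht (m - m') (by omega) (dvd_sub (h.six_dvd_triSum _)
    ((h.deleteMeeting N).six_dvd_triSum _))
  have h4 := triBound_add_le h1 hr m' (m - m')
  rw [Nat.add_sub_cancel' hmm.le] at h4
  zify at h4
  linarith

theorem triSum_le_of_tight [Fintype V] [DecidableEq V] (h : IsAdj a) {j m : ℕ} (hj : j < 7)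
    (hdeg : ∀ x, ∑ y, a x y ≤ (j + 2 : ℕ)) (hsum : ∑ x, ∑ y, a x y = 2 * m)
    (ih : ∀ m' < m, ∀ b : V → V → ℤ, IsAdj b → (∀ x, ∑ y, b x y ≤ (j + 2 : ℕ)) →
      ∑ x, ∑ y, b x y = 2 * m' → triSum univ b ≤ 6 * triBound (j + 2) m')
    {x y : V} (hxy : a x y = 1) (ht : (j : ℤ) + 1 ≤ ∑ z, a x z * a y z) :
    triSum univ a ≤ 6 * triBound (j + 2) m := by
  have hyx : a y x = 1 := by rw [h.symm, hxy]
  have hne : x ≠ y := by rintro rfl; simp [h.diag] at hxy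
  have hx1 : ∀ z ≠ y, a x z = 1 → a y z = 1 := fun z hz => h.adj_of_tight hdeg hxy
    (by push_cast; linarith) hz
  have hy1 : ∀ z ≠ x, a y z = 1 → a x z = 1 := fun z hz => h.adj_of_tight hdeg hyx
    (by simp only [mul_comm (a y _)]; push_cast; linarith) hz
  set S : Finset V := {z | a x z * a y z = 1} with hS
  have memS : ∀ z, z ∈ S ↔ a x z = 1 ∧ a y z = 1 := by
    intro z
    rcases h.zero_or_one x z with h1 | h1 <;> rcases h.zero_or_one y z with h2 | h2 <;>
      simp [hS, h1, h2]
  have cardS : #S = j + 1 := by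
    have e1 : (#S : ℤ) = ∑ z, a x z * a y z := by
      rw [hS, Finset.card_filter]
      push_cast
      refine Finset.sum_congr rfl fun z _ => ?_
      rcases h.zero_or_one x z with h1 | h1 <;> rcases h.zero_or_one y z with h2 | h2 <;>
        simp [h1, h2]
    have := h.codeg_le hdeg hxy
    push_cast at this
    omega
  have hTS : Disjoint ({x, y} : Finset V) S := by
    rw [Finset.disjoint_left]
    intro z hz hz'
    rw [memS] at hz'
    rcases Finset.mem_insert.1 hz with rfl | hz
    · simp [h.diag] at hz'
    · rw [Finset.mem_singleton] at hz; subst hz; simp [h.diag] at hz'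
  -- Take T = {x, y} and S the set of common neighbours; nothing outside T ∪ S is adjacent to T.
  obtain ⟨O, hO, hOP, hE, hT⟩ := h.deleteMeeting_bound (r := j + 2) hTS
    (by rw [Finset.card_pair hne, cardS]; ring)
    (by
      intro u hu z hz huz
      simp only [Finset.mem_union, Finset.mem_insert, Finset.mem_singleton, memS] at hu hz
      rcases hu with rfl | rfl <;> rcases hz with (rfl | rfl) | hz <;> simp_all)
    (by
      intro u hu z hz
      simp only [Finset.mem_compl, Finset.mem_union, Finset.mem_insert, Finset.mem_singleton,
        memS, not_or] at hu hz
      refine (h.zero_or_one u z).resolve_right fun huz => ?_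
      rcases hu with rfl | rfl
      · exact hz.2 ⟨huz, hx1 z hz.1.2 huz⟩
      · exact hz.2 ⟨hy1 z hz.1.1 huz, huz⟩)
    hdeg
  set P := ∑ x ∈ S, ∑ y ∈ S, _root_.missing a x y
  have hP := h.missing.sum_le S
  have hQ := h.missing.sum_deg_sq_le S
  have hQ' := h.missing.sum_deg_sq_le' S
  have hK := h.missing.triSum_nonneg S
  have hK' := h.missing.goodman S
  rw [cardS] at hP hQ' hK' hT
  push_cast at hP hQ' hK' hT hE
  refine h.triSum_le_of_deleteMeeting (by omega) (by omega) hdeg hsum ih ({x, y} ∪ S) ?_ ?_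
  · have : P ≤ (j + 1) * j := by linarith
    nlinarith
  · intro e he hdvd
    refine triBound_tight hj (P := P) (by linarith) hQ ?_ hK hK' hO hOP (by linarith) ?_ hdvd
    · ring_nf at hQ' ⊢; linarith
    · ring_nf at hT ⊢; linarith

theorem triSum_le_of_codeg_eq_six [Fintype V] [DecidableEq V] (h : IsAdj a) {m : ℕ}
    (hdeg : ∀ x, ∑ y, a x y ≤ (8 : ℕ)) (hsum : ∑ x, ∑ y, a x y = 2 * m)
    (ih : ∀ m' < m, ∀ b : V → V → ℤ, IsAdj b → (∀ x, ∑ y, b x y ≤ (8 : ℕ)) →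
      ∑ x, ∑ y, b x y = 2 * m' → triSum univ b ≤ 6 * triBound 8 m')
    (hc : ∀ x y, a x y = 1 → ∑ z, a x z * a y z = 6) {v : V} (hv : ∑ y, a v y = 8) :
    triSum univ a ≤ 6 * triBound 8 m := by
  set S : Finset V := {z | a v z = 1} with hS
  have memS : ∀ z, z ∈ S ↔ a v z = 1 := fun z => by simp [hS]
  have cardS : #S = 8 := by
    have := h.card_filter_eq_sum univ v
    rw [hv] at this
    exact_mod_cast this
  -- Each neighbour of v has 6 common neighbours with v among the 7 other vertices of S, so the
  -- missing graph on S is a perfect matching.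
  have degM : ∀ x ∈ S, ∑ y ∈ S, _root_.missing a x y = 1 := by
    intro x hx
    rw [deg_missing a S hx, cardS]
    have : ∑ y ∈ S, a x y = 6 := by
      rw [← hc v x ((memS x).1 hx), hS, Finset.sum_filter]
      refine Finset.sum_congr rfl fun z _ => ?_
      rcases h.zero_or_one v z with h1 | h1 <;> simp [h1]
    rw [this]; norm_num
  obtain ⟨O, hO, hOP, hE, hT⟩ := h.deleteMeeting_bound (r := 8) (T := {v}) (S := S)
    (by simp [memS, h.diag]) (by simp [cardS])
    (by
      intro u hu z hz huz
      simp only [Finset.mem_union, Finset.mem_singleton, memS] at hu hz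
      subst hu
      exact hz.resolve_left huz.symm)
    (by
      intro u hu z hz
      simp only [Finset.mem_compl, Finset.mem_union, Finset.mem_singleton, memS, not_or] at hu hz
      subst hu
      exact (h.zero_or_one u z).resolve_right hz.2)
    hdeg
  have hK := h.missing.triSum_nonneg S
  have e1 : ∑ x ∈ S, ∑ y ∈ S, _root_.missing a x y = 8 := by
    rw [Finset.sum_congr rfl degM]; simp [cardS]
  have e2 : ∑ x ∈ S, (∑ y ∈ S, _root_.missing a x y) ^ 2 = 8 := by
    rw [Finset.sum_congr rfl fun x hx => by rw [degM x hx]]; simp [cardS]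
  rw [e1, e2, cardS] at hT
  rw [e1] at hE hOP
  push_cast at hT hE
  refine h.triSum_le_of_deleteMeeting (by omega) le_rfl hdeg hsum ih ({v} ∪ S) (by linarith) ?_
  intro e he _
  have := triBound_matching hO hOP (e := e) (by linarith)
  linarith

/-- The bound for the maximum degree `r`, given the bound for `7` in case `r = 8`. -/
theorem triSum_le_aux [Fintype V] {r : ℕ} (h1 : 1 ≤ r) (hr : r ≤ 8)
    (h7 : r = 8 → ∀ (m : ℕ) (b : V → V → ℤ), IsAdj b → (∀ x, ∑ y, b x y ≤ (7 : ℕ)) →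
      ∑ x, ∑ y, b x y = 2 * m → triSum univ b ≤ 6 * triBound 7 m)
    (m : ℕ) (a : V → V → ℤ) (h : IsAdj a) (hdeg : ∀ x, ∑ y, a x y ≤ r)
    (hsum : ∑ x, ∑ y, a x y = 2 * m) : triSum univ a ≤ 6 * triBound r m := by
  classical
  induction m using Nat.strong_induction_on generalizing a with
  | _ m ih =>
  rcases lt_or_ge m ((r + 1).choose 2) with hm | hm
  · rw [triBound_eq_colexTri hm]
    exact h.triSum_le_colexTri (hm.trans_le (choose_two_bounds h1 hr).2) hsum
  -- For r = 1 the codegrees vanish and there are no triangles.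
  rcases Nat.lt_or_ge r 2 with hr2 | hr2
  · have := h.triSum_le_of_codeg_le fun x y hxy => h.codeg_le hdeg hxy
    have e : (r : ℤ) = 1 := by omega
    rw [e, sub_self, mul_zero] at this
    exact this.trans (by positivity)
  obtain ⟨j, rfl⟩ := Nat.exists_eq_add_of_le' hr2
  by_cases htight : ∃ x y, a x y = 1 ∧ (j : ℤ) + 1 ≤ ∑ z, a x z * a y z
  · obtain ⟨x, y, hxy, ht⟩ := htight
    exact h.triSum_le_of_tight (by omega) hdeg hsum ih hxy ht
  push Not at htight
  have hc : ∀ x y, a x y = 1 → ∑ z, a x z * a y z ≤ j := fun x y hxy =>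
    Int.lt_add_one_iff.1 (htight x y hxy)
  have hle := h.triSum_le_of_codeg_le hc
  obtain ⟨t, ht⟩ := h.six_dvd_triSum univ
  rw [hsum] at hle
  rcases Nat.lt_or_ge j 6 with hj | hj
  · have := triBound_ge h1 (by omega) hm
    zify at this
    rw [ht] at hle ⊢
    have : 6 * t < 6 * (triBound (j + 2) m : ℤ) + 6 := by nlinarith
    omega
  obtain rfl : j = 6 := by omega
  have hm36 : 36 ≤ m := hm
  have h8 := triBound_eight_ge hm36
  norm_num at hle hc
  -- A single edge of codegree below 6 makes the count of triangles strictly less than 2m, which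
  -- absorbs the deficit in `h8`.
  by_cases hlt : ∃ x y, a x y = 1 ∧ ∑ z, a x z * a y z < 6
  · obtain ⟨x, y, hxy, hlt⟩ := hlt
    have := h.triSum_lt_of_codeg_lt hc hxy hlt
    rw [hsum] at this
    norm_num
    omega
  push Not at hlt
  rcases triBound_eight_ge' m with h9 | h9
  · norm_num
    omega
  · by_cases hv : ∃ v, ∑ y, a v y = 8
    · obtain ⟨v, hv⟩ := hv
      exact h.triSum_le_of_codeg_eq_six hdeg hsum ih
        (fun x y hxy => le_antisymm (hc x y hxy) (hlt x y hxy)) hv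
    · push Not at hv
      have := h7 rfl m a h (fun x => by
        have := hdeg x
        have := hv x
        push_cast at *
        omega) hsum
      norm_num
      omega

/-- The maximum number of triangles of a graph with `m` edges and maximum degree at most `r`. -/
theorem triSum_le [Fintype V] {r : ℕ} (h1 : 1 ≤ r) (hr : r ≤ 8) (m : ℕ) (h : IsAdj a)
    (hdeg : ∀ x, ∑ y, a x y ≤ r) (hsum : ∑ x, ∑ y, a x y = 2 * m) :
    triSum univ a ≤ 6 * triBound r m :=
  triSum_le_aux h1 hr (fun _ => triSum_le_aux (by omega) (by omega) (by omega)) m a h hdeg hsum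

end IsAdj

end

/-! ### Passage from adjacency functions to simple graphs -/

/-- The adjacency function of a graph. -/
def adjFun {V : Type*} (G : SimpleGraph V) [DecidableRel G.Adj] (x y : V) : ℤ :=
  if G.Adj x y then 1 else 0

section Graph

variable {V : Type*} (G : SimpleGraph V) [DecidableRel G.Adj]

theorem isAdj_adjFun : IsAdj (adjFun G) where
  zero_or_one x y := by unfold adjFun; split_ifs <;> simp
  symm x y := by simp only [adjFun, G.adj_comm]
  diag x := by simp [adjFun]

theorem sum_adjFun_eq_degree [Fintype V] (x : V) : ∑ y, adjFun G x y = G.degree x := by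
  simp only [adjFun, Finset.sum_boole]
  rw [← SimpleGraph.card_neighborFinset_eq_degree, SimpleGraph.neighborFinset_eq_filter]

theorem sum_sum_adjFun [Fintype V] [DecidableEq V] :
    ∑ x, ∑ y, adjFun G x y = 2 * (G.edgeFinset.card : ℤ) := by
  simp only [sum_adjFun_eq_degree]
  exact_mod_cast G.sum_degrees_eq_twice_card_edges

theorem card_ordered_triangles [Fintype V] [DecidableEq V] {u v w : V} (huv : G.Adj u v)
    (huw : G.Adj u w) (hvw : G.Adj v w) :
    #{t : V × V × V | (G.Adj t.1 t.2.1 ∧ G.Adj t.2.1 t.2.2 ∧ G.Adj t.1 t.2.2) ∧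
      ({t.1, t.2.1, t.2.2} : Finset V) = {u, v, w}} = 6 := by
  have h1 := huv.ne
  have h2 := huw.ne
  have h3 := hvw.ne
  have : ({t : V × V × V | (G.Adj t.1 t.2.1 ∧ G.Adj t.2.1 t.2.2 ∧ G.Adj t.1 t.2.2) ∧
      ({t.1, t.2.1, t.2.2} : Finset V) = {u, v, w}} : Finset (V × V × V))
      = {(u, v, w), (u, w, v), (v, u, w), (v, w, u), (w, u, v), (w, v, u)} := by
    ext ⟨x, y, z⟩
    simp only [mem_filter, mem_univ, true_and, mem_insert, mem_singleton, Prod.mk.injEq]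
    constructor
    · rintro ⟨⟨hxy, hyz, hxz⟩, he⟩
      have hx : x ∈ ({u, v, w} : Finset V) := he ▸ by simp
      have hy : y ∈ ({u, v, w} : Finset V) := he ▸ by simp
      have hz : z ∈ ({u, v, w} : Finset V) := he ▸ by simp
      simp only [mem_insert, mem_singleton] at hx hy hz
      have := hxy.ne
      have := hyz.ne
      have := hxz.ne
      rcases hx with rfl | rfl | rfl <;> rcases hy with rfl | rfl | rfl <;>
        rcases hz with rfl | rfl | rfl <;> simp_all
    · rintro (⟨rfl, rfl, rfl⟩ | ⟨rfl, rfl, rfl⟩ | ⟨rfl, rfl, rfl⟩ | ⟨rfl, rfl, rfl⟩ |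
        ⟨rfl, rfl, rfl⟩ | ⟨rfl, rfl, rfl⟩) <;>
        refine ⟨by simp [huv, huw, hvw, huv.symm, huw.symm, hvw.symm], ?_⟩ <;>
        ext t <;> simp only [mem_insert, mem_singleton] <;> tauto
  rw [this]
  simp [h1, h2, h3, h1.symm, h2.symm, h3.symm]

theorem triSum_adjFun [Fintype V] [DecidableEq V] :
    triSum univ (adjFun G) = 6 * (cliqueCount 3 G : ℤ) := by
  have e1 : triSum univ (adjFun G)
      = #{t : V × V × V | G.Adj t.1 t.2.1 ∧ G.Adj t.2.1 t.2.2 ∧ G.Adj t.1 t.2.2} := by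
    rw [Finset.card_filter, Fintype.sum_prod_type]
    simp only [Fintype.sum_prod_type]
    push_cast
    unfold triSum adjFun
    refine Finset.sum_congr rfl fun x _ => Finset.sum_congr rfl fun y _ =>
      Finset.sum_congr rfl fun z _ => ?_
    by_cases h1 : G.Adj x y <;> by_cases h2 : G.Adj y z <;> by_cases h3 : G.Adj x z <;>
      simp [h1, h2, h3]
  -- Ordered triangles are grouped by their vertex set; every fibre has the six orderings.
  rw [e1, Finset.card_eq_sum_card_fiberwise (f := fun t => ({t.1, t.2.1, t.2.2} : Finset V))
    (t := G.cliqueFinset 3) (by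
      rintro ⟨x, y, z⟩ ht
      simp only [coe_filter, mem_univ, true_and, Set.mem_ofPred_eq] at ht
      simp only [mem_coe, SimpleGraph.mem_cliqueFinset_iff, SimpleGraph.is3Clique_triple_iff]
      tauto)]
  have e2 : ∀ s ∈ G.cliqueFinset 3, #{t ∈ ({t : V × V × V | G.Adj t.1 t.2.1 ∧ G.Adj t.2.1 t.2.2 ∧
      G.Adj t.1 t.2.2} : Finset (V × V × V)) | ({t.1, t.2.1, t.2.2} : Finset V) = s} = 6 := by
    intro s hs
    rw [SimpleGraph.mem_cliqueFinset_iff, SimpleGraph.is3Clique_iff] at hs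
    obtain ⟨u, v, w, huv, huw, hvw, rfl⟩ := hs
    rw [Finset.filter_filter]
    exact card_ordered_triangles G huv huw hvw
  rw [Finset.sum_congr rfl e2, Finset.sum_const, smul_eq_mul, cliqueCount]
  push_cast
  ring

end Graph

/-! ### Colexicographic order on pairs, and the colex graph -/

theorem toColex_pair_lt {n : ℕ} {i j k l : Fin n} (hij : i < j) (hkl : k < l) :
    toColex ({k, l} : Finset (Fin n)) < toColex {i, j} ↔ l < j ∨ l = j ∧ k < i := by
  rw [Finset.Colex.toColex_lt_toColex]
  simp only [mem_insert, mem_singleton, forall_eq_or_imp, forall_eq, exists_eq_or_imp,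
    exists_eq_left, not_or]
  constructor
  · rintro ⟨hne, h1, h2⟩
    rcases lt_trichotomy l j with h | h | h
    · exact Or.inl h
    · subst h
      refine Or.inr ⟨rfl, ?_⟩
      have : k ≠ i := by rintro rfl; exact hne rfl
      rcases h1 ⟨this, hkl.ne⟩ with h | h <;> omega
    · rcases h2 ⟨by omega, by omega⟩ with h | h <;> omega
  · rintro (h | ⟨rfl, h⟩)
    · refine ⟨fun he => ?_, fun _ => Or.inr ⟨⟨by omega, by omega⟩, by omega⟩,
        fun _ => Or.inr ⟨⟨by omega, by omega⟩, by omega⟩⟩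
      have : j ∈ ({k, l} : Finset (Fin n)) := he ▸ by simp
      simp only [mem_insert, mem_singleton] at this
      omega
    · refine ⟨fun he => ?_, fun _ => Or.inl ⟨⟨by omega, by omega⟩, by omega⟩,
        fun h' => absurd rfl h'.2⟩
      have : i ∈ ({k, l} : Finset (Fin n)) := he ▸ by simp
      simp only [mem_insert, mem_singleton] at this
      omega

/-- The predecessors of {i, j} are the pairs below j and the pairs {k, j} with k < i. Hence C(j,2) +
i is the position of the pair, counted from 0. -/
theorem card_colex_lt_pair {n : ℕ} {i j : Fin n} (hij : i < j) :
    #{s ∈ (univ : Finset (Fin n)).powersetCard 2 | toColex s < toColex ({i, j} : Finset (Fin n))}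
      = (j : ℕ).choose 2 + i := by
  have : {s ∈ (univ : Finset (Fin n)).powersetCard 2 |
      toColex s < toColex ({i, j} : Finset (Fin n))}
      = (Iio j).powersetCard 2 ∪ (Iio i).image fun k => ({k, j} : Finset (Fin n)) := by
    ext s
    simp only [mem_filter, mem_powersetCard, subset_univ, true_and, mem_union, mem_image, mem_Iio]
    constructor
    · rintro ⟨hs, hlt⟩
      obtain ⟨x, y, hxy, rfl⟩ := Finset.card_eq_two.1 hs
      wlog h : x < y generalizing x y
      · rw [Finset.pair_comm] at hs hlt ⊢
        exact this y x hxy.symm hs hlt (lt_of_le_of_ne (not_lt.1 h) hxy.symm)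
      rw [toColex_pair_lt hij h] at hlt
      rcases hlt with h1 | ⟨rfl, h1⟩
      · refine Or.inl ⟨fun z hz => ?_, hs⟩
        simp only [mem_insert, mem_singleton] at hz
        rw [mem_Iio]
        omega
      · exact Or.inr ⟨x, h1, rfl⟩
    · rintro (⟨hs, hc⟩ | ⟨k, hk, rfl⟩)
      · refine ⟨hc, ?_⟩
        obtain ⟨x, y, hxy, rfl⟩ := Finset.card_eq_two.1 hc
        wlog h : x < y generalizing x y
        · rw [Finset.pair_comm] at hs hc ⊢
          exact this y x hxy.symm hs hc (lt_of_le_of_ne (not_lt.1 h) hxy.symm)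
        rw [toColex_pair_lt hij h]
        exact Or.inl (mem_Iio.1 (hs (by simp)))
      · exact ⟨Finset.card_pair (hk.trans hij).ne,
          (toColex_pair_lt hij (hk.trans hij)).2 (Or.inr ⟨rfl, hk⟩)⟩
  rw [this, Finset.card_union_of_disjoint, Finset.card_powersetCard, Fin.card_Iio,
    Finset.card_image_of_injOn, Fin.card_Iio]
  · intro k hk l hl he
    have h1 : k ∈ ({l, j} : Finset (Fin n)) := by
      have he' : ({k, j} : Finset (Fin n)) = {l, j} := he
      rw [← he']; simp
    simp only [mem_insert, mem_singleton, coe_Iio, Set.mem_Iio] at h1 hk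
    exact h1.resolve_right (hk.trans hij).ne
  · rw [Finset.disjoint_left]
    rintro s hs hs'
    obtain ⟨k, -, rfl⟩ := mem_image.1 hs'
    have := (mem_powersetCard.1 hs).1 (show j ∈ ({k, j} : Finset (Fin n)) by simp)
    simp at this

/-- The adjacency function of the colex graph, on the natural numbers. -/
def colexAdj (b i j : ℕ) : ℤ :=
  if i ≠ j ∧ (max i j).choose 2 + min i j < b then 1 else 0

theorem isAdj_colexAdj (b : ℕ) : IsAdj (colexAdj b) where
  zero_or_one x y := by unfold colexAdj; split_ifs <;> simp
  symm x y := by simp only [colexAdj, max_comm, min_comm, ne_comm]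
  diag x := by simp [colexAdj]

theorem colexAdj_of_lt {b i j : ℕ} (h : i < j) :
    colexAdj b i j = if j.choose 2 + i < b then 1 else 0 := by
  simp [colexAdj, h.ne, max_eq_right h.le, min_eq_left h.le]

theorem adjFun_colexGraph (b : ℕ) (i j : Fin (b + 1)) :
    adjFun (colexGraph b) i j = colexAdj b i j := by
  rcases lt_trichotomy i j with h | rfl | h
  · rw [colexAdj_of_lt h]
    simp only [adjFun, colexGraph, card_colex_lt_pair h]
    simp [h.ne]
  · rw [(isAdj_adjFun _).diag, (isAdj_colexAdj b).diag]
  · rw [(isAdj_adjFun _).symm, (isAdj_colexAdj b).symm, colexAdj_of_lt h]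
    simp only [adjFun, colexGraph, card_colex_lt_pair h]
    simp [h.ne]

namespace IsAdj

theorem sum_range {a : ℕ → ℕ → ℤ} (h : IsAdj a) (n : ℕ) :
    ∑ x ∈ range n, ∑ y ∈ range n, a x y = 2 * ∑ j ∈ range n, ∑ i ∈ range j, a i j := by
  induction n with
  | zero => simp
  | succ n ih =>
    rw [Finset.sum_range_succ (n := n) (f := fun j => ∑ i ∈ range j, a i j), mul_add, ← ih,
      Finset.range_add_one, h.sum_insert Finset.notMem_range_self]

theorem triSum_range {a : ℕ → ℕ → ℤ} (h : IsAdj a) (n : ℕ) :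
    triSum (range n) a
      = 6 * ∑ j ∈ range n, ∑ i ∈ range j, ∑ k ∈ range i, a j k * a k i * a j i := by
  induction n with
  | zero => simp [triSum]
  | succ n ih =>
    rw [Finset.sum_range_succ (n := n), mul_add, ← ih, Finset.range_add_one,
      h.triSum_insert Finset.notMem_range_self, (h.neighborhood n).sum_range]
    ring

end IsAdj

theorem choose_two_succ (n : ℕ) : (n + 1).choose 2 = n + n.choose 2 := by
  rw [Nat.choose_succ_succ' n 1, Nat.choose_one_right]

theorem sum_range_choose_two (φ : ℕ → ℤ) (n : ℕ) :
    ∑ j ∈ range n, ∑ i ∈ range j, φ (j.choose 2 + i) = ∑ x ∈ range (n.choose 2), φ x := by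
  induction n with
  | zero => simp
  | succ n ih =>
    rw [Finset.sum_range_succ, ih, choose_two_succ, add_comm n,
      Finset.sum_range_add]

theorem colexMin_choose_two_add {i j : ℕ} (h : i < j) : colexMin (j.choose 2 + i) = i := by
  have h1 : (j + 1).choose 2 = j + j.choose 2 := choose_two_succ j
  -- This puts j within the search range x + 1 of `colexMin`.
  have h2 : j ≤ j.choose 2 + 1 := by
    rcases Nat.lt_or_ge j 3 with h3 | h3
    · interval_cases j <;> decide
    · have := Nat.add_one_mul_choose_eq (j - 1) 1
      rw [Nat.choose_one_right, Nat.sub_add_cancel (by omega)] at this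
      nlinarith [Nat.sub_add_cancel (show 1 ≤ j by omega)]
  have : Nat.findGreatest (fun l => l.choose 2 ≤ j.choose 2 + i) (j.choose 2 + i + 1) = j := by
    rw [Nat.findGreatest_eq_iff]
    refine ⟨by omega, fun _ => by omega, fun l hl _ => ?_⟩
    have := Nat.choose_le_choose 2 (show j + 1 ≤ l from hl)
    omega
  rw [colexMin, this]
  omega

theorem sum_range_ite_lt {b n : ℕ} (h : b ≤ n) (φ : ℕ → ℤ) :
    ∑ x ∈ range n, (if x < b then φ x else 0) = ∑ x ∈ range b, φ x := by
  rw [← Finset.sum_filter]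
  congr 1
  ext x
  simp only [mem_filter, mem_range]
  omega

theorem le_choose_two (b : ℕ) : b ≤ (b + 1).choose 2 := by
  rw [choose_two_succ]
  exact Nat.le_add_right _ _

theorem sum_colexAdj (b : ℕ) :
    ∑ x ∈ range (b + 1), ∑ y ∈ range (b + 1), colexAdj b x y = 2 * b := by
  have : ∑ j ∈ range (b + 1), ∑ i ∈ range j, colexAdj b i j
      = ∑ j ∈ range (b + 1), ∑ i ∈ range j, (if j.choose 2 + i < b then (1 : ℤ) else 0) :=
    Finset.sum_congr rfl fun j _ => Finset.sum_congr rfl fun i hi =>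
      colexAdj_of_lt (mem_range.1 hi)
  rw [(isAdj_colexAdj b).sum_range, this,
    sum_range_choose_two fun x => if x < b then (1 : ℤ) else 0,
    sum_range_ite_lt (le_choose_two b) fun _ => 1]
  simp

theorem triSum_colexAdj (b : ℕ) :
    triSum (range (b + 1)) (colexAdj b) = 6 * colexTri b := by
  have : ∑ j ∈ range (b + 1), ∑ i ∈ range j, ∑ k ∈ range i,
        colexAdj b j k * colexAdj b k i * colexAdj b j i
      = ∑ j ∈ range (b + 1), ∑ i ∈ range j,
        (if j.choose 2 + i < b then (colexMin (j.choose 2 + i) : ℤ) else 0) := by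
    refine Finset.sum_congr rfl fun j _ => Finset.sum_congr rfl fun i hi => ?_
    rw [mem_range] at hi
    rw [colexMin_choose_two_add hi]
    -- For k < i < j the pairs {k, i} and {k, j} precede {i, j}, so the edge {i, j} closes a
    -- triangle with every k < i, that is, i triangles.
    have h0 : ∀ k ∈ range i, colexAdj b j k * colexAdj b k i * colexAdj b j i
        = if j.choose 2 + i < b then 1 else 0 := by
      intro k hk
      rw [mem_range] at hk
      rw [(isAdj_colexAdj b).symm j k, (isAdj_colexAdj b).symm j i, colexAdj_of_lt hi,
        colexAdj_of_lt hk, colexAdj_of_lt (hk.trans hi)]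
      have h4 := Nat.choose_le_choose 2 (show i + 1 ≤ j from hi)
      rw [choose_two_succ] at h4
      by_cases h1 : j.choose 2 + i < b
      · rw [if_pos h1, if_pos (by omega), if_pos (by omega)]; rfl
      · rw [if_neg h1, mul_zero]
    rw [Finset.sum_congr rfl h0]
    simp
  rw [(isAdj_colexAdj b).triSum_range, this,
    sum_range_choose_two fun x => if x < b then (colexMin x : ℤ) else 0,
    sum_range_ite_lt (le_choose_two b) fun x => (colexMin x : ℤ), colexTri]
  push_cast
  rfl

theorem sum_adjFun_colexGraph (b : ℕ) : ∑ x, ∑ y, adjFun (colexGraph b) x y = 2 * b := by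
  simp only [adjFun_colexGraph]
  rw [← sum_colexAdj, ← Fin.sum_univ_eq_sum_range fun x => ∑ y ∈ range (b + 1), colexAdj b x y]
  refine Finset.sum_congr rfl fun x _ => ?_
  rw [← Fin.sum_univ_eq_sum_range fun y => colexAdj b x y]

theorem triSum_adjFun_colexGraph (b : ℕ) :
    triSum univ (adjFun (colexGraph b)) = 6 * colexTri b := by
  unfold triSum
  simp only [adjFun_colexGraph]
  rw [← triSum_colexAdj, triSum, ← Fin.sum_univ_eq_sum_range fun x => ∑ y ∈ range (b + 1),
    ∑ z ∈ range (b + 1), colexAdj b x y * colexAdj b y z * colexAdj b x z]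
  refine Finset.sum_congr rfl fun x _ => ?_
  rw [← Fin.sum_univ_eq_sum_range fun y => ∑ z ∈ range (b + 1),
    colexAdj b x y * colexAdj b y z * colexAdj b x z]
  refine Finset.sum_congr rfl fun y _ => ?_
  rw [← Fin.sum_univ_eq_sum_range fun z => colexAdj b x y * colexAdj b y z * colexAdj b x z]

/-! ### Edges, triangles and degrees of the extremal graph -/

theorem adjFun_cliques_inl_inl (r a b : ℕ) (x y : Fin a × Fin (r + 1)) :
    adjFun (cliquesWithColex r a b) (.inl x) (.inl y)
      = if x.1 = y.1 then if x.2 = y.2 then 0 else 1 else 0 := by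
  by_cases h1 : x.1 = y.1 <;> by_cases h2 : x.2 = y.2 <;>
    simp [adjFun, cliquesWithColex, disjointCopies, h1, h2]

theorem adjFun_cliques_inr_inr (r a b : ℕ) (x y : Fin (b + 1)) :
    adjFun (cliquesWithColex r a b) (.inr x) (.inr y) = adjFun (colexGraph b) x y := by
  simp [adjFun, cliquesWithColex]

theorem adjFun_cliques_inl_inr (r a b : ℕ) (x : Fin a × Fin (r + 1)) (y : Fin (b + 1)) :
    adjFun (cliquesWithColex r a b) (.inl x) (.inr y) = 0 := by
  simp [adjFun, cliquesWithColex]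

theorem adjFun_cliques_inr_inl (r a b : ℕ) (x : Fin (b + 1)) (y : Fin a × Fin (r + 1)) :
    adjFun (cliquesWithColex r a b) (.inr x) (.inl y) = 0 := by
  simp [adjFun, cliquesWithColex]

theorem sum_ite_eq_zero_one {n : ℕ} (x : Fin (n + 1)) :
    ∑ y, (if x = y then (0 : ℤ) else 1) = n := by
  have : ∀ y, (if x = y then (0 : ℤ) else 1) = 1 - if x = y then 1 else 0 := fun y => by
    split_ifs <;> simp
  simp [this]

theorem sum_adjFun_cliques_inl (r a b : ℕ) (x : Fin a × Fin (r + 1)) :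
    ∑ y, adjFun (cliquesWithColex r a b) (.inl x) y = r := by
  simp only [Fintype.sum_sum_type, adjFun_cliques_inl_inl, adjFun_cliques_inl_inr,
    Fintype.sum_prod_type, Finset.sum_ite_irrel, sum_ite_eq_zero_one, Finset.sum_const_zero,
    Finset.sum_ite_eq, mem_univ, if_true, add_zero]

theorem sum_adjFun_cliques_inr (r a b : ℕ) (x : Fin (b + 1)) :
    ∑ y, adjFun (cliquesWithColex r a b) (.inr x) y = ∑ y, adjFun (colexGraph b) x y := by
  simp only [Fintype.sum_sum_type, adjFun_cliques_inr_inl, adjFun_cliques_inr_inr,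
    Finset.sum_const_zero, zero_add]

theorem card_edgeFinset_cliquesWithColex (r a b : ℕ) :
    (cliquesWithColex r a b).edgeFinset.card = a * (r + 1).choose 2 + b := by
  have h := sum_sum_adjFun (cliquesWithColex r a b)
  rw [Fintype.sum_sum_type] at h
  simp only [sum_adjFun_cliques_inl, sum_adjFun_cliques_inr, sum_adjFun_colexGraph] at h
  have h2 : (r + 1) * r = (r + 1).choose 2 * 2 := by
    have := Nat.add_one_mul_choose_eq r 1
    rwa [Nat.choose_one_right] at this
  simp only [Finset.sum_const, Finset.card_univ, Fintype.card_prod, Fintype.card_fin,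
    nsmul_eq_mul] at h
  zify at h2 ⊢
  push_cast at h
  have : 2 * ((cliquesWithColex r a b).edgeFinset.card : ℤ)
      = 2 * (a * ((r + 1).choose 2 : ℤ) + b) := by linear_combination (a : ℤ) * h2 - h
  omega

theorem triSum_complete (r : ℕ) :
    triSum (univ : Finset (Fin (r + 1))) (fun x y => if x = y then 0 else 1)
      = 6 * (r + 1).choose 3 := by
  have h : IsAdj fun x y : Fin (r + 1) => if x = y then (0 : ℤ) else 1 :=
    ⟨fun x y => by split_ifs <;> simp, fun x y => by simp only [eq_comm],
      fun x => by simp⟩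
  have h0 : missing (fun x y : Fin (r + 1) => if x = y then (0 : ℤ) else 1) = fun _ _ => 0 := by
    funext x y
    simp [missing]
  have h1 : (r + 1).choose 3 * 6 = (r + 1) * r * (r - 1) := by
    rcases r with _ | r
    · rfl
    · have e1 := Nat.add_one_mul_choose_eq (r + 1) 2
      have e2 := Nat.add_one_mul_choose_eq r 1
      rw [Nat.choose_one_right] at e2
      simp only [Nat.add_sub_cancel]
      norm_num at e1 e2 ⊢
      nlinarith
  rw [h.triSum_eq_missing, h0]
  simp only [triSum, Finset.sum_const_zero, mul_zero, Finset.card_univ, Fintype.card_fin]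
  rcases r with _ | r
  · simp; rfl
  · simp only [Nat.add_sub_cancel] at h1
    zify at h1
    push_cast
    norm_num
    linarith

theorem cliqueCount_three_cliquesWithColex (r a b : ℕ) :
    cliqueCount 3 (cliquesWithColex r a b) = a * (r + 1).choose 3 + colexTri b := by
  have h := triSum_adjFun (cliquesWithColex r a b)
  have h1 := triSum_adjFun_colexGraph b
  have h2 := triSum_complete r
  have h3 : triSum univ (adjFun (cliquesWithColex r a b))
      = a * triSum (univ : Finset (Fin (r + 1))) (fun x y => if x = y then 0 else 1)
        + triSum univ (adjFun (colexGraph b)) := by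
    have e : ∀ (i j k : Fin a) (x y z : Fin (r + 1)),
        (if i = j then if x = y then (0 : ℤ) else 1 else 0)
          * (if j = k then if y = z then 0 else 1 else 0)
          * (if i = k then if x = z then 0 else 1 else 0)
        = if i = j then if i = k then (if x = y then (0 : ℤ) else 1) * (if y = z then 0 else 1)
          * (if x = z then 0 else 1) else 0 else 0 := by
      intro i j k x y z
      by_cases h1 : i = j
      · subst h1; by_cases h2 : i = k <;> simp [h2]
      · simp [h1]
    simp only [triSum, Fintype.sum_sum_type, adjFun_cliques_inl_inl, adjFun_cliques_inl_inr,
      adjFun_cliques_inr_inl, adjFun_cliques_inr_inr, Fintype.sum_prod_type, mul_zero, zero_mul,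
      Finset.sum_const_zero, add_zero, zero_add, e, Finset.sum_ite_irrel, Finset.sum_ite_eq,
      mem_univ, if_true]
    have e' : ∀ c : ℤ, ∑ _i : Fin a, c = a * c := by simp
    rw [← e']
  rw [h3, h2, h1] at h
  zify
  linarith

/-- The first C(r+1,2) pairs are those inside {0, ..., r}, so a non-isolated vertex has its
neighbours among the r others there. -/
theorem sum_adjFun_colexGraph_le {r b : ℕ} (hb : b < (r + 1).choose 2) (i : Fin (b + 1)) :
    ∑ j, adjFun (colexGraph b) i j ≤ r := by
  have key : ∀ i j, colexAdj b i j = 1 → i < r + 1 ∧ j < r + 1 ∧ j ≠ i := by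
    intro i j h
    unfold colexAdj at h
    split_ifs at h with h1
    swap
    · simp at h
    have : max i j < r + 1 := by
      by_contra! hlt
      have := Nat.choose_le_choose 2 hlt
      omega
    exact ⟨by omega, by omega, h1.1.symm⟩
  simp only [adjFun_colexGraph]
  rw [Fin.sum_univ_eq_sum_range fun j => colexAdj b i j, ← (isAdj_colexAdj b).card_filter_eq_sum]
  norm_cast
  rcases Finset.eq_empty_or_nonempty {z ∈ range (b + 1) | colexAdj b i z = 1} with h | ⟨z, hz⟩
  · rw [h]; simp
  · have hi := (key i z (mem_filter.1 hz).2).1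
    refine (Finset.card_le_card (t := (range (r + 1)).erase i) fun j hj => ?_).trans ?_
    · have := key i j (mem_filter.1 hj).2
      exact mem_erase.2 ⟨this.2.2, mem_range.2 this.2.1⟩
    · rw [Finset.card_erase_of_mem (mem_range.2 hi), Finset.card_range, Nat.add_sub_cancel]

theorem maxDegree_cliquesWithColex_le {r a b : ℕ} (hb : b < (r + 1).choose 2) :
    (cliquesWithColex r a b).maxDegree ≤ r := by
  refine SimpleGraph.maxDegree_le_of_forall_degree_le _ _ fun x => ?_
  zify
  rw [← sum_adjFun_eq_degree]
  rcases x with x | x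
  · rw [sum_adjFun_cliques_inl]
  · rw [sum_adjFun_cliques_inr]; exact sum_adjFun_colexGraph_le hb x

theorem mainTheorem1 (r m a b : ℕ) (hr : r ≤ 8)
    (hm : m = a * (r + 1).choose 2 + b) (hb : b < (r + 1).choose 2) :
    ((cliquesWithColex r a b).edgeFinset.card = m ∧ (cliquesWithColex r a b).maxDegree ≤ r) ∧
    ∀ {V : Type*} [Fintype V] [DecidableEq V] (G : SimpleGraph V) [DecidableRel G.Adj],
      G.edgeFinset.card = m → G.maxDegree ≤ r →
        cliqueCount 3 G ≤ cliqueCount 3 (cliquesWithColex r a b) := by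
  refine ⟨⟨?_, maxDegree_cliquesWithColex_le hb⟩, ?_⟩
  · rw [hm, card_edgeFinset_cliquesWithColex]
  intro V _ _ G _ hG hdeg
  -- For r = 0 the condition on b fails, since C(1,2) = 0.
  have h1 : 1 ≤ r := by
    rcases r with _ | r
    · simp at hb
    · omega
  have hB := (choose_two_bounds h1 hr).1
  have key := (isAdj_adjFun G).triSum_le h1 hr m
    (fun x => by
      rw [sum_adjFun_eq_degree]
      exact_mod_cast (G.degree_le_maxDegree x).trans hdeg)
    (by rw [sum_sum_adjFun, hG])
  have hF : triBound r m = a * (r + 1).choose 3 + colexTri b := by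
    rw [triBound, hm, mul_comm a, Nat.mul_add_div hB, Nat.mul_add_mod, Nat.div_eq_of_lt hb,
      Nat.mod_eq_of_lt hb, add_zero]
  rw [triSum_adjFun, hF] at key
  rw [cliqueCount_three_cliquesWithColex]
  omega
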